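/- Let $G$ be a finite directed graph (loops and parallel edges allowed) with vertex set $\{0,\dots,n-1\}$ and edge set $E(G)=\{0,\dots,m-1\}$, with positive real edge weights $w\colon E(G)\to\mathbb R_{>0}$, let $s,t\in V(G)$, and let $P$ be a shortest path from $s$ to $t$ in $(G,w)$, that is, an $s$-$t$ path (without repeated vertices) of minimum total weight. A set $S\subseteq E(G)$ is an anti-forcing set for $P$ if $S\cap E(P)=\varnothing$ and $S\cap E(P')\neq\varnothing$ for every shortest $s$-$t$ path $P'$ in $(G,w)$ with $E(P')\ne E(P)$; it is minimum if no anti-forcing set for $P$ has fewer elements. Theorem. Given $(G,w)$, $s$, $t$ and $P$, a minimum anti-forcing set for $P$ can be computed in polynomial time. That is, there are a single program for a random access machine and a polynomial $p$ with natural number coefficients such that for every input $(G,w,s,t,P)$ as above (the numbers $n,m,s,t$ and $|E(P)|$, the tails and heads of the edges, the sequence of edges of $P$ and the edge weights being stored in memory) the program halts after at most $p(n+m)$ steps and outputs (the indicator vector of) a minimum anti-forcing set for $P$. Here the machine has memory for natural numbers and for real numbers, with indirect addressing, and its unit-cost operations are memory access, natural number constants, addition, truncated subtraction and comparison of natural numbers,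 and addition, subtraction and comparison of real numbers. -/

import Mathlib

/-! ## Forcing notions for an abstract property -/

/-- For a property `F` (a family of subsets of a finite set `E`) and `X ∈ F`, a set `S ⊆ E` is an
anti-forcing set for `X` if `S ∩ X = ∅` and `S` meets every other member of `F`. -/
def IsAntiForcingSet {E : Type} [DecidableEq E] (F : Set (Finset E)) (X S : Finset E) : Prop :=
  X ∈ F ∧ S ∩ X = ∅ ∧ ∀ X' ∈ F, X' ≠ X → S ∩ X' ≠ ∅

/-- A minimum anti-forcing set for `X`: an anti-forcing set for `X` of least cardinality. -/
def IsMinimumAntiForcingSet {E : Type} [DecidableEq E] (F : Set (Finset E)) (X S : Finset E) :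
    Prop :=
  IsAntiForcingSet F X S ∧ ∀ S' : Finset E, IsAntiForcingSet F X S' → S.card ≤ S'.card

/-! ## Weighted digraphs and shortest paths -/

/-- A directed graph with vertex set `Fin n` and edge set `Fin m`, and with positive real edge
weights; the edge `e` goes from `tail e` to `head e`. Loops and parallel edges are allowed; the
simple digraphs are those where `e ↦ (tail e, head e)` is injective. -/
structure WeightedDigraph (n m : ℕ) where
  tail : Fin m → Fin n
  head : Fin m → Fin n
  weight : Fin m → ℝ
  weight_pos : ∀ e, 0 < weight e

namespace WeightedDigraph

variable {n m : ℕ}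

/-- `G.IsWalk u p v`: the edges of the list `p`, in this order, form a walk from `u` to `v`. -/
def IsWalk (G : WeightedDigraph n m) : Fin n → List (Fin m) → Fin n → Prop
  | u, [], v => u = v
  | u, e :: p, v => G.tail e = u ∧ G.IsWalk (G.head e) p v

/-- `G.IsPath u p v`: a walk from `u` to `v` that visits no vertex twice. -/
def IsPath (G : WeightedDigraph n m) (u : Fin n) (p : List (Fin m)) (v : Fin n) : Prop :=
  G.IsWalk u p v ∧ (u :: p.map G.head).Nodup

/-- The length of a path: the sum of its edge weights. -/
noncomputable def length (G : WeightedDigraph n m) (p : List (Fin m)) : ℝ :=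
  (p.map G.weight).sum

/-- `G.IsShortestPath s t p`: `p` is a path from `s` to `t` of least length. -/
def IsShortestPath (G : WeightedDigraph n m) (s t : Fin n) (p : List (Fin m)) : Prop :=
  G.IsPath s p t ∧ ∀ q : List (Fin m), G.IsPath s q t → G.length p ≤ G.length q

/-- The family of the edge sets of all shortest paths from `s` to `t`. -/
def shortestPaths (G : WeightedDigraph n m) (s t : Fin n) : Set (Finset (Fin m)) :=
  {X | ∃ p : List (Fin m), G.IsShortestPath s t p ∧ p.toFinset = X}

end WeightedDigraph

/-! ## The model of computation

A random access machine with natural number memory and real number memory, programmed by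
structured programs. On natural numbers it has constants, addition, truncated subtraction and
comparison, on real numbers only addition, subtraction and comparison (no real constants, no
multiplication, no rounding, no conversion between the two sorts). This is the usual
comparison-addition model for graphs with real edge weights. Every operation, memory access and
test has unit cost; without multiplication a computation of `T` steps adds at most `T` bits to the
numbers involved, so that unit cost is polynomially equivalent to bit cost on rational data. -/

namespace RAM

/-- The memory: the cell with index `i` of the array `a`, for each of the two sorts. A program
mentions only finitely many arrays by name, but can access any of their cells. -/
structure State where
  nat : ℕ → ℕ → ℕ
  real : ℕ → ℕ → ℝ

/-- Natural number expressions; `get a i` reads the cell `i` of the array `a`. -/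
inductive NExpr : Type
  | const (k : ℕ)
  | get (a : ℕ) (i : NExpr)
  | add (x y : NExpr)
  | sub (x y : NExpr)

/-- Real number expressions. -/
inductive RExpr : Type
  | get (a : ℕ) (i : NExpr)
  | add (x y : RExpr)
  | sub (x y : RExpr)

/-- Tests. -/
inductive Test : Type
  | natLe (x y : NExpr)
  | realLe (x y : RExpr)
  | neg (b : Test)
  | conj (b c : Test)

/-- Programs: writing to a cell, sequencing, branching and loops. -/
inductive Program : Type
  | skip
  | setNat (a : ℕ) (i : NExpr) (x : NExpr)
  | setReal (a : ℕ) (i : NExpr) (x : RExpr)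
  | seq (c d : Program)
  | branch (b : Test) (c d : Program)
  | loop (b : Test) (c : Program)

def NExpr.eval (σ : State) : NExpr → ℕ
  | .const k => k
  | .get a i => σ.nat a (i.eval σ)
  | .add x y => x.eval σ + y.eval σ
  | .sub x y => x.eval σ - y.eval σ

/-- The number of unit cost operations in the evaluation of an expression. -/
def NExpr.cost : NExpr → ℕ
  | .const _ => 1
  | .get _ i => i.cost + 1
  | .add x y => x.cost + y.cost + 1
  | .sub x y => x.cost + y.cost + 1

noncomputable def RExpr.eval (σ : State) : RExpr → ℝ
  | .get a i => σ.real a (i.eval σ)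
  | .add x y => x.eval σ + y.eval σ
  | .sub x y => x.eval σ - y.eval σ

def RExpr.cost : RExpr → ℕ
  | .get _ i => i.cost + 1
  | .add x y => x.cost + y.cost + 1
  | .sub x y => x.cost + y.cost + 1

def Test.Holds (σ : State) : Test → Prop
  | .natLe x y => x.eval σ ≤ y.eval σ
  | .realLe x y => x.eval σ ≤ y.eval σ
  | .neg b => ¬ b.Holds σ
  | .conj b c => b.Holds σ ∧ c.Holds σ

def Test.cost : Test → ℕ
  | .natLe x y => x.cost + y.cost + 1
  | .realLe x y => x.cost + y.cost + 1
  | .neg b => b.cost + 1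
  | .conj b c => b.cost + c.cost + 1

/-- Writing the value `v` to the cell `i` of the natural number array `a`. -/
def State.setNat (σ : State) (a i v : ℕ) : State :=
  { σ with nat := Function.update σ.nat a (Function.update (σ.nat a) i v) }

/-- Writing the value `v` to the cell `i` of the real number array `a`. -/
def State.setReal (σ : State) (a i : ℕ) (v : ℝ) : State :=
  { σ with real := Function.update σ.real a (Function.update (σ.real a) i v) }

/-- `Run c σ T τ`: the program `c`, started in the state `σ`, halts in the state `τ` after exactly
`T` steps. (A program that does not halt from `σ` has no run from `σ`.) -/
inductive Run : Program → State → ℕ → State → Prop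
  | skip (σ : State) : Run .skip σ 1 σ
  | setNat (σ : State) (a : ℕ) (i x : NExpr) :
      Run (.setNat a i x) σ (i.cost + x.cost + 1) (σ.setNat a (i.eval σ) (x.eval σ))
  | setReal (σ : State) (a : ℕ) (i : NExpr) (x : RExpr) :
      Run (.setReal a i x) σ (i.cost + x.cost + 1) (σ.setReal a (i.eval σ) (x.eval σ))
  | seq {c d : Program} {σ τ ρ : State} {T U : ℕ} :
      Run c σ T τ → Run d τ U ρ → Run (.seq c d) σ (T + U) ρ
  | branchTrue {b : Test} {c d : Program} {σ τ : State} {T : ℕ} :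
      b.Holds σ → Run c σ T τ → Run (.branch b c d) σ (b.cost + T) τ
  | branchFalse {b : Test} {c d : Program} {σ τ : State} {T : ℕ} :
      ¬ b.Holds σ → Run d σ T τ → Run (.branch b c d) σ (b.cost + T) τ
  | loopTrue {b : Test} {c : Program} {σ τ ρ : State} {T U : ℕ} :
      b.Holds σ → Run c σ T τ → Run (.loop b c) τ U ρ → Run (.loop b c) σ (b.cost + T + U) ρ
  | loopFalse {b : Test} {c : Program} {σ : State} :
      ¬ b.Holds σ → Run (.loop b c) σ b.cost σ

/-- The machine is deterministic: the final state and the number of steps are determined by the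
program and the initial state. -/
theorem Run.deterministic {c : Program} {σ τ τ' : State} {T T' : ℕ}
    (h : Run c σ T τ) (h' : Run c σ T' τ') : T = T' ∧ τ = τ' := by
  induction h generalizing T' τ' with
  | skip => cases h'; exact ⟨rfl, rfl⟩
  | setNat => cases h'; exact ⟨rfl, rfl⟩
  | setReal => cases h'; exact ⟨rfl, rfl⟩
  | seq _ _ ih₁ ih₂ =>
    cases h' with
    | seq k₁ k₂ =>
      obtain ⟨rfl, rfl⟩ := ih₁ k₁
      obtain ⟨rfl, rfl⟩ := ih₂ k₂
      exact ⟨rfl, rfl⟩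
  | branchTrue hb _ ih =>
    cases h' with
    | branchTrue _ k => obtain ⟨rfl, rfl⟩ := ih k; exact ⟨rfl, rfl⟩
    | branchFalse hb' _ => exact absurd hb hb'
  | branchFalse hb _ ih =>
    cases h' with
    | branchTrue hb' _ => exact absurd hb' hb
    | branchFalse _ k => obtain ⟨rfl, rfl⟩ := ih k; exact ⟨rfl, rfl⟩
  | loopTrue hb _ _ ih₁ ih₂ =>
    cases h' with
    | loopTrue _ k₁ k₂ =>
      obtain ⟨rfl, rfl⟩ := ih₁ k₁
      obtain ⟨rfl, rfl⟩ := ih₂ k₂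
      exact ⟨rfl, rfl⟩
    | loopFalse hb' => exact absurd hb hb'
  | loopFalse hb =>
    cases h' with
    | loopTrue hb' _ _ => exact absurd hb' hb
    | loopFalse _ => exact ⟨rfl, rfl⟩

end RAM

/-! ## Input and output -/

/-- The initial memory for the input `(G, s, t, P)`: the natural number array `0` holds
`n, m, s, t` and the number of edges of `P`, the arrays `1` and `2` hold the tails and heads of the
edges, the array `3` holds the edges of `P` in their order along `P`, and the real number array `0`
holds the edge weights. All other cells are `0`. -/
noncomputable def inputState {n m : ℕ} (G : WeightedDigraph n m) (s t : Fin n)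
    (P : List (Fin m)) : RAM.State where
  nat a i :=
    match a with
    | 0 => [n, m, (s : ℕ), (t : ℕ), P.length].getD i 0
    | 1 => if h : i < m then (G.tail ⟨i, h⟩ : ℕ) else 0
    | 2 => if h : i < m then (G.head ⟨i, h⟩ : ℕ) else 0
    | 3 => (P.map Fin.val).getD i 0
    | _ => 0
  real a i :=
    match a with
    | 0 => if h : i < m then G.weight ⟨i, h⟩ else 0
    | _ => 0

/-- The final memory `τ` represents the edge set `S`: the first `m` cells of the natural number
array `4` hold the indicator vector of `S`. -/
def Outputs {m : ℕ} (τ : RAM.State) (S : Finset (Fin m)) : Prop :=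
  ∀ e : Fin m, τ.nat 4 (e : ℕ) = if e ∈ S then 1 else 0

/-! ## Reasoning about programs -/

namespace RAM

/-! A feasible potential `d` with `d t - d s` equal to the length of `P` turns shortest paths into a
reachability notion: the shortest paths from `s` to `t` are exactly the walks of tight edges
(`isShortestPath_iff`). Since weights are positive, `d` strictly increases along tight edges, so
such walks never repeat a vertex. Bellman–Ford provides `d` (`Relaxed.isPotential`,
`Relaxed.apply_sink`).

A second shortest path must leave `P` and return to it along tight edges outside `P`. Conversely,
any such detour between vertices of `P` can be completed along `P` to another shortest path. Let the
tight edges outside `P` leave a common source `n` whenever they leave `P`, and enter a common sink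
`n + 1` whenever they enter `P`. Then every cut separating `n` from `n + 1` is anti-forcing
(`isAntiForcingSet_cutEdges`), and every anti-forcing set contains such a cut
(`exists_cutEdges_subset`). The task is therefore a minimum cut with unit capacities.

The cut is found by moving one unit of flow at a time, guided by distance-like labels. Once the
label at the current vertex reaches the number of vertices, some smaller positive label is unused by
pigeonhole, and the vertices above this gap form a minimum cut (`IsPreflow.cutCard_le`). An integer
potential that grows with every move bounds the number of moves. The program is verified with a
small calculus of total correctness: `Halts` for time bounds, `halts_loop` for loops, and `Frame`
for untouched arrays. -/

theorem State.nat_setNat_self (σ : State) (a i v : ℕ) :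
    (σ.setNat a i v).nat a = Function.update (σ.nat a) i v := by
  simp [State.setNat]

theorem State.nat_setNat_of_ne (σ : State) {a b : ℕ} (i v : ℕ) (h : b ≠ a) :
    (σ.setNat a i v).nat b = σ.nat b := by
  simp [State.setNat, h]

theorem State.real_setNat (σ : State) (a i v : ℕ) : (σ.setNat a i v).real = σ.real := rfl

theorem State.real_setReal_self (σ : State) (a i : ℕ) (v : ℝ) :
    (σ.setReal a i v).real a = Function.update (σ.real a) i v := by
  simp [State.setReal]

theorem State.real_setReal_of_ne (σ : State) {a b : ℕ} (i : ℕ) (v : ℝ) (h : b ≠ a) :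
    (σ.setReal a i v).real b = σ.real b := by
  simp [State.setReal, h]

theorem State.nat_setReal (σ : State) (a i : ℕ) (v : ℝ) : (σ.setReal a i v).nat = σ.nat := rfl

/-- A program without loops. -/
def Program.LoopFree : Program → Prop
  | .seq c d => c.LoopFree ∧ d.LoopFree
  | .branch _ c d => c.LoopFree ∧ d.LoopFree
  | .loop _ _ => False
  | _ => True

/-- An upper bound for the number of steps of a loop-free program. -/
def Program.cost : Program → ℕ
  | .skip => 1
  | .setNat _ i x => i.cost + x.cost + 1
  | .setReal _ i x => i.cost + x.cost + 1
  | .seq c d => c.cost + d.cost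
  | .branch b c d => b.cost + (c.cost + d.cost)
  -- A default value: only loop-free programs are ever measured by `cost` or run by `exec`.
  | .loop _ _ => 0

open Classical in
/-- The final state of a loop-free program. -/
noncomputable def Program.exec : Program → State → State
  | .skip, σ => σ
  | .setNat a i x, σ => σ.setNat a (i.eval σ) (x.eval σ)
  | .setReal a i x, σ => σ.setReal a (i.eval σ) (x.eval σ)
  | .seq c d, σ => d.exec (c.exec σ)
  | .branch b c d, σ => if b.Holds σ then c.exec σ else d.exec σ
  | .loop _ _, σ => σ

theorem Program.exec_branch_of_holds {b : Test} {c d : Program} {σ : State} (h : b.Holds σ) :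
    (Program.branch b c d).exec σ = c.exec σ := by
  simp [Program.exec, h]

theorem Program.exec_branch_of_not_holds {b : Test} {c d : Program} {σ : State}
    (h : ¬ b.Holds σ) : (Program.branch b c d).exec σ = d.exec σ := by
  simp [Program.exec, h]

theorem Program.LoopFree.exists_run {c : Program} (hc : c.LoopFree) (σ : State) :
    ∃ T ≤ c.cost, Run c σ T (c.exec σ) := by
  induction c generalizing σ with
  | skip => exact ⟨_, le_rfl, .skip σ⟩
  | setNat a i x => exact ⟨_, le_rfl, .setNat σ a i x⟩
  | setReal a i x => exact ⟨_, le_rfl, .setReal σ a i x⟩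
  | seq c d ihc ihd =>
    obtain ⟨T, hT, h⟩ := ihc hc.1 σ
    obtain ⟨U, hU, h'⟩ := ihd hc.2 (c.exec σ)
    exact ⟨T + U, Nat.add_le_add hT hU, .seq h h'⟩
  | branch b c d ihc ihd =>
    by_cases hb : b.Holds σ
    · obtain ⟨T, hT, h⟩ := ihc hc.1 σ
      rw [Program.exec_branch_of_holds hb]
      exact ⟨b.cost + T, by simp only [Program.cost]; omega, .branchTrue hb h⟩
    · obtain ⟨T, hT, h⟩ := ihd hc.2 σ
      rw [Program.exec_branch_of_not_holds hb]
      exact ⟨b.cost + T, by simp only [Program.cost]; omega, .branchFalse hb h⟩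
  | loop b c => exact hc.elim

/-- The natural number arrays that a program writes to. -/
def Program.natTargets : Program → List ℕ
  | .setNat a _ _ => [a]
  | .seq c d => c.natTargets ++ d.natTargets
  | .branch _ c d => c.natTargets ++ d.natTargets
  | .loop _ c => c.natTargets
  | _ => []

/-- The real number arrays that a program writes to. -/
def Program.realTargets : Program → List ℕ
  | .setReal a _ _ => [a]
  | .seq c d => c.realTargets ++ d.realTargets
  | .branch _ c d => c.realTargets ++ d.realTargets
  | .loop _ c => c.realTargets
  | _ => []

/-- The arrays that `c` does not write to agree in `σ` and `τ`. -/
structure Frame (c : Program) (σ τ : State) : Prop where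
  nat : ∀ a, a ∉ c.natTargets → τ.nat a = σ.nat a
  real : ∀ a, a ∉ c.realTargets → τ.real a = σ.real a

theorem Frame.refl (c : Program) (σ : State) : Frame c σ σ := ⟨fun _ _ => rfl, fun _ _ => rfl⟩

theorem Frame.trans {c : Program} {σ τ ρ : State} (h : Frame c σ τ) (h' : Frame c τ ρ) :
    Frame c σ ρ :=
  ⟨fun a ha => (h'.nat a ha).trans (h.nat a ha), fun a ha => (h'.real a ha).trans (h.real a ha)⟩

/-- Allows specifications and invariants to omit every array that a phase does not write. Which
arrays these are is a decidable syntactic condition, settled later by `decide`. -/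
theorem Run.frame {c : Program} {σ τ : State} {T : ℕ} (h : Run c σ T τ) : Frame c σ τ := by
  induction h with
  | skip => exact .refl _ _
  | setNat σ a i x =>
    refine ⟨fun b hb => ?_, fun _ _ => rfl⟩
    exact State.nat_setNat_of_ne _ _ _ (by simpa [Program.natTargets] using hb)
  | setReal σ a i x =>
    refine ⟨fun _ _ => rfl, fun b hb => ?_⟩
    exact State.real_setReal_of_ne _ _ _ (by simpa [Program.realTargets] using hb)
  | seq _ _ ih₁ ih₂ =>
    constructor
    · intro a ha
      simp only [Program.natTargets, List.mem_append, not_or] at ha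
      rw [ih₂.nat a ha.2, ih₁.nat a ha.1]
    · intro a ha
      simp only [Program.realTargets, List.mem_append, not_or] at ha
      rw [ih₂.real a ha.2, ih₁.real a ha.1]
  | branchTrue _ _ ih =>
    constructor
    · intro a ha
      simp only [Program.natTargets, List.mem_append, not_or] at ha
      exact ih.nat a ha.1
    · intro a ha
      simp only [Program.realTargets, List.mem_append, not_or] at ha
      exact ih.real a ha.1
  | branchFalse _ _ ih =>
    constructor
    · intro a ha
      simp only [Program.natTargets, List.mem_append, not_or] at ha
      exact ih.nat a ha.2
    · intro a ha
      simp only [Program.realTargets, List.mem_append, not_or] at ha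
      exact ih.real a ha.2
  | loopTrue _ _ _ ih₁ ih₂ => exact Frame.trans ⟨ih₁.nat, ih₁.real⟩ ih₂
  | loopFalse => exact .refl _ _

/-- From `σ` the program `c` halts after at most `T` steps in a state with `Q`. -/
def Halts (c : Program) (σ : State) (T : ℕ) (Q : State → Prop) : Prop :=
  ∃ U τ, Run c σ U τ ∧ U ≤ T ∧ Q τ

theorem Halts.mono {c : Program} {σ : State} {T U : ℕ} {Q R : State → Prop}
    (h : Halts c σ T Q) (hT : T ≤ U) (hQ : ∀ τ, Frame c σ τ → Q τ → R τ) : Halts c σ U R := by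
  obtain ⟨V, τ, hr, hV, hq⟩ := h
  exact ⟨V, τ, hr, hV.trans hT, hQ τ hr.frame hq⟩

theorem Halts.seq {c d : Program} {σ : State} {T U V : ℕ} {Q R : State → Prop}
    (h : Halts c σ T Q) (hV : T + U ≤ V) (h' : ∀ τ, Frame c σ τ → Q τ → Halts d τ U R) :
    Halts (.seq c d) σ V R := by
  obtain ⟨T', τ, hr, hT, hq⟩ := h
  obtain ⟨U', ρ, hr', hU, hq'⟩ := h' τ hr.frame hq
  exact ⟨T' + U', ρ, .seq hr hr', (Nat.add_le_add hT hU).trans hV, hq'⟩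

theorem Program.LoopFree.halts {c : Program} (hc : c.LoopFree) {σ : State} {T : ℕ}
    {Q : State → Prop} (hT : c.cost ≤ T) (h : Q (c.exec σ)) : Halts c σ T Q := by
  obtain ⟨U, hU, hr⟩ := hc.exists_run σ
  exact ⟨U, _, hr, hU.trans hT, h⟩

/-- The loop rule, for a loop with a loop-free body, an invariant `I` and a variant `μ`. -/
theorem halts_loop {b : Test} {c : Program} (hc : c.LoopFree) (I : State → Prop)
    (μ : State → ℕ) {σ : State} {T : ℕ} {Q : State → Prop} (hI : I σ)
    (hT : (μ σ + 1) * (b.cost + c.cost) ≤ T)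
    (hQ : ∀ τ, Frame c σ τ → I τ → ¬ b.Holds τ → Q τ)
    (step : ∀ τ, Frame c σ τ → I τ → b.Holds τ → I (c.exec τ) ∧ μ (c.exec τ) < μ τ) :
    Halts (.loop b c) σ T Q := by
  suffices H : ∀ k τ, μ τ ≤ k → Frame c σ τ → I τ →
      Halts (.loop b c) τ ((k + 1) * (b.cost + c.cost)) Q from
    (H _ σ le_rfl (.refl _ _) hI).mono hT fun _ _ h => h
  intro k
  induction k with
  | zero =>
    intro τ hμ hF hτ
    have hb : ¬ b.Holds τ := fun hb => by have := (step τ hF hτ hb).2; omega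
    exact ⟨_, τ, .loopFalse hb, by nlinarith, hQ τ hF hτ hb⟩
  | succ k ih =>
    intro τ hμ hF hτ
    by_cases hb : b.Holds τ
    · obtain ⟨h₁, h₂⟩ := step τ hF hτ hb
      obtain ⟨T, hT, hr⟩ := hc.exists_run τ
      obtain ⟨U, ρ, hr', hU, hρ⟩ := ih (c.exec τ) (by omega) (hF.trans hr.frame) h₁
      refine ⟨_, ρ, .loopTrue hb hr hr', ?_, hρ⟩
      calc b.cost + T + U ≤ b.cost + c.cost + (k + 1) * (b.cost + c.cost) := by omega
        _ = (k + 1 + 1) * (b.cost + c.cost) := by ring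
    · exact ⟨_, τ, .loopFalse hb, by nlinarith, hQ τ hF hτ hb⟩

end RAM

/-! ## Walks, paths and potentials -/

namespace WeightedDigraph

variable {n m : ℕ} {G : WeightedDigraph n m} {s t u v x : Fin n} {p q : List (Fin m)}

theorem IsWalk.append (hp : G.IsWalk u p v) (hq : G.IsWalk v q x) : G.IsWalk u (p ++ q) x := by
  induction p generalizing u with
  | nil => cases hp; exact hq
  | cons e p ih => exact ⟨hp.1, ih hp.2⟩

theorem isWalk_append : G.IsWalk u (p ++ q) x ↔ ∃ v, G.IsWalk u p v ∧ G.IsWalk v q x := by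
  refine ⟨fun h => ?_, fun ⟨v, h, h'⟩ => h.append h'⟩
  induction p generalizing u with
  | nil => exact ⟨u, rfl, h⟩
  | cons e p ih =>
    obtain ⟨v, h₁, h₂⟩ := ih h.2
    exact ⟨v, ⟨h.1, h₁⟩, h₂⟩

theorem length_nil : G.length [] = 0 := rfl

theorem length_cons (e : Fin m) : G.length (e :: p) = G.weight e + G.length p := by
  simp [length]

theorem length_append : G.length (p ++ q) = G.length p + G.length q := by
  simp [length]

theorem length_nonneg (p : List (Fin m)) : 0 ≤ G.length p :=
  List.sum_nonneg fun x hx => by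
    obtain ⟨e, -, rfl⟩ := List.mem_map.1 hx
    exact (G.weight_pos e).le

/-- A walk can be cut at each of its vertices. -/
theorem IsWalk.exists_split (hp : G.IsWalk u p v) (hx : x ∈ u :: p.map G.head) :
    ∃ p₁ p₂, p = p₁ ++ p₂ ∧ G.IsWalk u p₁ x ∧ G.IsWalk x p₂ v := by
  induction p generalizing u with
  | nil =>
    obtain rfl : x = u := by simpa using hx
    exact ⟨[], [], rfl, rfl, hp⟩
  | cons e p ih =>
    rcases List.mem_cons.1 hx with rfl | hx
    · exact ⟨[], e :: p, rfl, rfl, hp⟩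
    · obtain ⟨p₁, p₂, rfl, h₁, h₂⟩ := ih hp.2 (by simpa using hx)
      exact ⟨e :: p₁, p₂, rfl, ⟨hp.1, h₁⟩, h₂⟩

theorem IsWalk.end_mem (hp : G.IsWalk u p v) : v ∈ u :: p.map G.head := by
  induction p generalizing u with
  | nil => cases hp; simp
  | cons e p ih => simpa using Or.inr (ih hp.2)

theorem IsWalk.tail_mem (hp : G.IsWalk u p v) {e : Fin m} (he : e ∈ p) :
    G.tail e ∈ u :: p.map G.head := by
  induction p generalizing u with
  | nil => simp at he
  | cons d p ih =>
    rcases List.mem_cons.1 he with rfl | he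
    · simp [hp.1]
    · exact List.mem_cons_of_mem _ (by simpa using ih hp.2 he)

/-- Every walk can be shortened to a path. -/
theorem IsWalk.exists_isPath (hp : G.IsWalk u p v) :
    ∃ q, G.IsPath u q v ∧ G.length q ≤ G.length p := by
  induction p generalizing u with
  | nil => exact ⟨[], ⟨hp, by simp⟩, le_rfl⟩
  | cons e p ih =>
    obtain ⟨q, hq, hl⟩ := ih hp.2
    by_cases hu : u ∈ G.head e :: q.map G.head
    · obtain ⟨q₁, q₂, rfl, h₁, h₂⟩ := hq.1.exists_split hu
      refine ⟨q₂, ⟨h₂, ?_⟩, ?_⟩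
      -- The vertex `u` was the head of the last edge cut off (`e` itself if `q₁` is empty), so `u`
      -- followed by the heads of `q₂` is a suffix of a list without repetitions.
      · rcases q₁.eq_nil_or_concat with rfl | ⟨r, d, rfl⟩
        · obtain rfl : G.head e = u := h₁
          simpa using hq.2
        · obtain ⟨y, hy, hd⟩ := isWalk_append.1 (List.concat_eq_append ▸ h₁)
          obtain ⟨-, rfl⟩ : G.tail d = y ∧ G.head d = u := hd
          have := hq.2
          rw [List.concat_eq_append, List.append_assoc, List.map_append, List.singleton_append,
            List.map_cons] at this
          exact (List.nodup_cons.1 this).2.of_append_right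
      · rw [length_append] at hl
        rw [length_cons]
        linarith [G.weight_pos e, length_nonneg (G := G) q₁]
    · exact ⟨e :: q, ⟨⟨hp.1, hq.1⟩, by
        simpa using List.nodup_cons.2 ⟨hu, hq.2⟩⟩, by simpa [length_cons] using hl⟩

theorem IsPath.length_lt (hp : G.IsPath u p v) : p.length < n := by
  have := hp.2.length_le_card
  simpa using this

theorem IsPath.nodup (hp : G.IsPath u p v) : p.Nodup :=
  (List.nodup_cons.1 hp.2).2.of_map _

theorem IsPath.length_eq_sum (hp : G.IsPath u p v) :
    G.length p = ∑ e ∈ p.toFinset, G.weight e := by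
  rw [List.sum_toFinset _ hp.nodup, length]

/-! ### Feasible potentials and tight edges -/

/-- A feasible potential `d`: no edge is shorter than the potential difference of its ends. -/
def IsPotential (G : WeightedDigraph n m) (d : Fin n → ℝ) : Prop :=
  ∀ e, d (G.head e) ≤ d (G.tail e) + G.weight e

/-- The edges as long as the potential difference of their ends. -/
def IsTight (G : WeightedDigraph n m) (d : Fin n → ℝ) (e : Fin m) : Prop :=
  d (G.tail e) + G.weight e ≤ d (G.head e)

variable {d : Fin n → ℝ}

theorem IsWalk.le_of_isPotential (hd : G.IsPotential d) (hp : G.IsWalk u p v) :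
    d v ≤ d u + G.length p := by
  induction p generalizing u with
  | nil => cases hp; simp [length_nil]
  | cons e p ih =>
    have := ih hp.2
    have := hd e
    rw [hp.1] at this
    rw [length_cons]
    linarith

theorem IsWalk.add_length_le (hp : G.IsWalk u p v) (ht : ∀ e ∈ p, G.IsTight d e) :
    d u + G.length p ≤ d v := by
  induction p generalizing u with
  | nil => cases hp; simp [length_nil]
  | cons e p ih =>
    have h₁ := ih hp.2 fun f hf => ht f (by simp [hf])
    have h₂ := ht e (by simp)
    rw [IsTight, hp.1] at h₂
    rw [length_cons]
    linarith

/-- The edge inequalities telescope along the walk, so slack on a single edge would make the total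
inequality strict. -/
theorem IsWalk.isTight (hd : G.IsPotential d) (hp : G.IsWalk u p v)
    (hl : d u + G.length p ≤ d v) : ∀ e ∈ p, G.IsTight d e := by
  induction p generalizing u with
  | nil => simp
  | cons e p ih =>
    rw [length_cons] at hl
    have h₁ := hp.2.le_of_isPotential hd
    have h₂ := hd e
    rw [hp.1] at h₂
    intro f hf
    rcases List.mem_cons.1 hf with rfl | hf
    · rw [IsTight, hp.1]; linarith
    · exact ih hp.2 (by linarith) f hf

/-- A walk of tight edges visits no vertex twice. -/
theorem IsWalk.isPath_of_isTight (hp : G.IsWalk u p v) (ht : ∀ e ∈ p, G.IsTight d e) :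
    G.IsPath u p v := by
  refine ⟨hp, ?_⟩
  induction p generalizing u with
  | nil => simp
  | cons e p ih =>
    have htp : ∀ f ∈ p, G.IsTight d f := fun f hf => ht f (by simp [hf])
    refine List.nodup_cons.2 ⟨fun hu => ?_, by simpa using ih hp.2 htp⟩
    -- A return to `u` would close a tight walk of positive length between equal potentials.
    obtain ⟨q₁, q₂, rfl, h₁, -⟩ := hp.2.exists_split (by simpa using hu)
    have h₂ := h₁.add_length_le fun f hf => htp f (by simp [hf])
    have h₃ := ht e (by simp)
    rw [IsTight, hp.1] at h₃
    linarith [G.weight_pos e, length_nonneg (G := G) q₁]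

/-- The shortest paths are the walks of tight edges. -/
theorem isShortestPath_iff (hd : G.IsPotential d) {P : List (Fin m)}
    (hP : G.IsShortestPath s t P) (hst : d s + G.length P = d t) :
    G.IsShortestPath s t q ↔ G.IsWalk s q t ∧ ∀ e ∈ q, G.IsTight d e := by
  constructor
  · intro hq
    refine ⟨hq.1.1, hq.1.1.isTight hd ?_⟩
    linarith [hq.2 P hP.1]
  · rintro ⟨hq, ht⟩
    refine ⟨hq.isPath_of_isTight ht, fun r hr => ?_⟩
    linarith [hP.2 r hr, hq.add_length_le ht]

/-! ## Anti-forcing sets as cuts -/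

/-- The new tail of an edge in the contraction of the vertices in `V`: the tight edges outside of
`P` leave the source `n` instead of a vertex in `V`, and all other edges become loops. -/
noncomputable def cutTail (G : WeightedDigraph n m) (d : Fin n → ℝ) (V : List (Fin n))
    (P : List (Fin m)) (e : Fin m) : ℕ :=
  open Classical in
  if G.IsTight d e ∧ e ∉ P then (if G.tail e ∈ V then n else G.tail e) else n

/-- The new head of an edge in the contraction of the vertices in `V`: the tight edges outside of
`P` enter the sink `n + 1` instead of a vertex in `V`, and all other edges become loops. -/
noncomputable def cutHead (G : WeightedDigraph n m) (d : Fin n → ℝ) (V : List (Fin n))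
    (P : List (Fin m)) (e : Fin m) : ℕ :=
  open Classical in
  if G.IsTight d e ∧ e ∉ P then (if G.head e ∈ V then n + 1 else G.head e) else n

open Classical in
/-- The edges that leave a vertex set after the contraction. -/
noncomputable def cutEdges (G : WeightedDigraph n m) (d : Fin n → ℝ) (V : List (Fin n))
    (P : List (Fin m)) (A : Finset ℕ) : Finset (Fin m) :=
  {e | G.cutTail d V P e ∈ A ∧ G.cutHead d V P e ∉ A}

theorem mem_cutEdges {V : List (Fin n)} {P : List (Fin m)} {A : Finset ℕ} {e : Fin m} :
    e ∈ G.cutEdges d V P A ↔ G.cutTail d V P e ∈ A ∧ G.cutHead d V P e ∉ A := by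
  simp [cutEdges]

open Classical in
theorem cutTail_of_isTight {V : List (Fin n)} {P : List (Fin m)} {e : Fin m}
    (h : G.IsTight d e ∧ e ∉ P) :
    G.cutTail d V P e = if G.tail e ∈ V then n else (G.tail e : ℕ) := by
  rw [cutTail, if_pos h]

open Classical in
theorem cutHead_of_isTight {V : List (Fin n)} {P : List (Fin m)} {e : Fin m}
    (h : G.IsTight d e ∧ e ∉ P) :
    G.cutHead d V P e = if G.head e ∈ V then n + 1 else (G.head e : ℕ) := by
  rw [cutHead, if_pos h]

theorem isTight_of_mem_cutEdges {V : List (Fin n)} {P : List (Fin m)} {A : Finset ℕ}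
    {e : Fin m} (h : e ∈ G.cutEdges d V P A) : G.IsTight d e ∧ e ∉ P := by
  by_contra hn
  rw [mem_cutEdges, cutTail, cutHead, if_neg hn, if_neg hn] at h
  exact h.2 h.1

/-- A shortest path that avoids the cut can never leave `P`: the first edge off `P` starts at the
source side, and without crossing the cut the path cannot come back to `P`, although it ends at `t`,
a vertex of `P`. -/
theorem isAntiForcingSet_cutEdges (hd : G.IsPotential d) {P : List (Fin m)}
    (hP : G.IsShortestPath s t P) (hst : d s + G.length P = d t) {A : Finset ℕ}
    (hs : n ∈ A) (ht : n + 1 ∉ A) :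
    IsAntiForcingSet (G.shortestPaths s t) P.toFinset
      (G.cutEdges d (s :: P.map G.head) P A) := by
  set V := s :: P.map G.head with hV
  refine ⟨⟨P, hP, rfl⟩, ?_, ?_⟩
  · rw [← Finset.disjoint_iff_inter_eq_empty, Finset.disjoint_left]
    intro e he
    simpa using (isTight_of_mem_cutEdges he).2
  rintro X ⟨q, hq, rfl⟩ hX hcut
  have hS : ∀ e ∈ q, e ∉ G.cutEdges d V P A := fun e he he' => by
    have : e ∈ G.cutEdges d V P A ∩ q.toFinset := by simp [he, he']
    simp [hcut] at this
  obtain ⟨hw, htq⟩ := (isShortestPath_iff hd hP hst).1 hq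
  -- Induction on the remaining walk to `t`, that is, backward from `t`. The two claims feed each
  -- other: a vertex off `P` from which `t` is reached without crossing the cut lies on the sink
  -- side, so no edge outside `P` can start on `P`.
  have key : ∀ (r : List (Fin m)) (u : Fin n), G.IsWalk u r t → (∀ e ∈ r, G.IsTight d e) →
      (∀ e ∈ r, e ∉ G.cutEdges d V P A) →
      (u ∉ V → (u : ℕ) ∈ A → False) ∧ (u ∈ V → ∀ e ∈ r, e ∈ P) := by
    intro r
    induction r with
    | nil =>
      intro u hu _ _
      obtain rfl : u = t := hu
      exact ⟨fun h => absurd hP.1.1.end_mem h, by simp⟩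
    | cons e r ih =>
      classical
      intro u hu htr hSr
      obtain ⟨ih₁, ih₂⟩ := ih _ hu.2 (fun f hf => htr f (by simp [hf]))
        (fun f hf => hSr f (by simp [hf]))
      have he := hSr e (by simp)
      have hte := htr e (by simp)
      have step : e ∉ P → (if u ∈ V then n else (u : ℕ)) ∈ A → False := by
        intro heP hA
        have hh : (if G.head e ∈ V then n + 1 else (G.head e : ℕ)) ∈ A := by
          by_contra hh
          refine he ?_
          rw [mem_cutEdges, cutTail_of_isTight ⟨hte, heP⟩, cutHead_of_isTight ⟨hte, heP⟩, hu.1]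
          exact ⟨hA, hh⟩
        split_ifs at hh with hv
        · exact ht hh
        · exact ih₁ hv hh
      refine ⟨fun huV huA => ?_, fun huV f hf => ?_⟩
      · refine step (fun heP => huV ?_) (by simpa [huV] using huA)
        rw [← hu.1]
        exact hP.1.1.tail_mem heP
      · have heP : e ∈ P := by
          by_contra heP
          exact step heP (by simpa [huV] using hs)
        rcases List.mem_cons.1 hf with rfl | hf
        · exact heP
        · exact ih₂ (List.mem_cons_of_mem _ (List.mem_map_of_mem heP)) f hf
  have hsub : q.toFinset ⊆ P.toFinset := fun e he => by
    simpa using (key q s hw htq hS).2 (by simp [hV]) e (by simpa using he)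
  -- A proper subset of the edges of `P` would be strictly lighter by positivity of the weights,
  -- contradicting minimality of `P`.
  refine hX (Finset.eq_of_subset_of_card_le hsub ?_)
  by_contra hlt
  obtain ⟨e, he, heq⟩ := Finset.exists_of_ssubset
    (Finset.ssubset_iff_subset_ne.2 ⟨hsub, fun h => hlt (by rw [h])⟩)
  have h₁ : G.length q < G.length P := by
    rw [hq.1.length_eq_sum, hP.1.length_eq_sum]
    exact Finset.sum_lt_sum_of_subset hsub he heq (G.weight_pos e)
      fun f _ _ => (G.weight_pos f).le
  linarith [hP.2 q hq.1]

/-- Every anti-forcing set contains a cut. -/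
theorem exists_cutEdges_subset (hd : G.IsPotential d) {P : List (Fin m)}
    (hP : G.IsShortestPath s t P) (hst : d s + G.length P = d t) {S : Finset (Fin m)}
    (hS : IsAntiForcingSet (G.shortestPaths s t) P.toFinset S) :
    ∃ A : Finset ℕ, n ∈ A ∧ n + 1 ∉ A ∧ G.cutEdges d (s :: P.map G.head) P A ⊆ S := by
  classical
  set V := s :: P.map G.head with hV
  -- The cut is the reachability cut: `R` is reachability from `P` along tight edges outside `P` and
  -- `S`. An edge that leaves it without lying in `S` would extend reachability, either to a new
  -- vertex off `P` or back to `P`.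
  let R : Fin n → Prop := fun v => ∃ u ∈ V, ∃ q, G.IsWalk u q v ∧
    ∀ e ∈ q, G.IsTight d e ∧ e ∉ P ∧ e ∉ S
  let B : Finset (Fin n) := {v | v ∉ V ∧ R v}
  refine ⟨insert n (B.map Fin.valEmbedding), by simp, ?_, ?_⟩
  · simp only [Finset.mem_insert, Finset.mem_map, not_or]
    refine ⟨by omega, ?_⟩
    rintro ⟨v, -, hv⟩
    have := v.2
    simp only [Fin.valEmbedding_apply] at hv
    omega
  have hmem : ∀ v : Fin n, (v : ℕ) ∈ insert n (B.map Fin.valEmbedding) ↔ v ∉ V ∧ R v := by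
    intro v
    rw [Finset.mem_insert, or_iff_right v.2.ne]
    simp [B, Fin.val_inj]
  intro e he
  have hte := isTight_of_mem_cutEdges he
  rw [mem_cutEdges, cutTail_of_isTight hte, cutHead_of_isTight hte] at he
  by_contra heS
  have htail : R (G.tail e) := by
    by_cases hv : G.tail e ∈ V
    · exact ⟨_, hv, [], rfl, by simp⟩
    · have := he.1
      rw [if_neg hv, hmem] at this
      exact this.2
  obtain ⟨u, hu, q, hq, hqS⟩ := htail
  have hq' : G.IsWalk u (q ++ [e]) (G.head e) := hq.append ⟨rfl, rfl⟩
  have hqS' : ∀ f ∈ q ++ [e], G.IsTight d f ∧ f ∉ P ∧ f ∉ S := by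
    intro f hf
    rcases List.mem_append.1 hf with hf | hf
    · exact hqS f hf
    · obtain rfl : f = e := by simpa using hf
      exact ⟨hte.1, hte.2, heS⟩
  by_cases hv : G.head e ∈ V
  swap
  · refine he.2 ?_
    rw [if_neg hv, hmem]
    exact ⟨hv, u, hu, _, hq', hqS'⟩
  obtain ⟨p₁, r₁, hp₁, hw₁, -⟩ := hP.1.1.exists_split hu
  obtain ⟨r₂, p₂, hp₂, -, hw₂⟩ := hP.1.1.exists_split hv
  have hPt := ((isShortestPath_iff hd hP hst).1 hP).2
  have hm₁ : ∀ f ∈ p₁, f ∈ P := fun f hf => by rw [hp₁]; simp [hf]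
  have hm₂ : ∀ f ∈ p₂, f ∈ P := fun f hf => by rw [hp₂]; simp [hf]
  have hPS : ∀ f ∈ P, f ∉ S := fun f hf hfS => by
    have : f ∈ S ∩ P.toFinset := by simp [hf, hfS]
    simp [hS.2.1] at this
  -- Follow `P` to `u`, take the detour, then follow `P` from its end. The order of the two vertices
  -- on `P` need not be examined, because a walk of tight edges is automatically a shortest path.
  refine hS.2.2 (p₁ ++ ((q ++ [e]) ++ p₂)).toFinset ⟨_, (isShortestPath_iff hd hP hst).2
    ⟨hw₁.append (hq'.append hw₂), ?_⟩, rfl⟩ ?_ ?_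
  · intro f hf
    rcases List.mem_append.1 hf with hf | hf
    · exact hPt f (hm₁ f hf)
    rcases List.mem_append.1 hf with hf | hf
    · exact (hqS' f hf).1
    · exact hPt f (hm₂ f hf)
  · intro h
    have : e ∈ P.toFinset := by rw [← h]; simp
    exact hte.2 (by simpa using this)
  · rw [← Finset.disjoint_iff_inter_eq_empty, Finset.disjoint_left]
    intro f hfS hf
    rw [List.mem_toFinset] at hf
    rcases List.mem_append.1 hf with hf | hf
    · exact hPS f (hm₁ f hf) hfS
    rcases List.mem_append.1 hf with hf | hf
    · exact (hqS' f hf).2.2 hfS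
    · exact hPS f (hm₂ f hf) hfS

theorem isMinimumAntiForcingSet_cutEdges (hd : G.IsPotential d) {P : List (Fin m)}
    (hP : G.IsShortestPath s t P) (hst : d s + G.length P = d t) {A : Finset ℕ}
    (hs : n ∈ A) (ht : n + 1 ∉ A)
    (hA : ∀ B : Finset ℕ, n ∈ B → n + 1 ∉ B →
      (G.cutEdges d (s :: P.map G.head) P A).card ≤
        (G.cutEdges d (s :: P.map G.head) P B).card) :
    IsMinimumAntiForcingSet (G.shortestPaths s t) P.toFinset
      (G.cutEdges d (s :: P.map G.head) P A) := by
  refine ⟨isAntiForcingSet_cutEdges hd hP hst hs ht, fun S hS => ?_⟩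
  obtain ⟨B, h₁, h₂, h₃⟩ := exists_cutEdges_subset hd hP hst hS
  exact (hA B h₁ h₂).trans (Finset.card_le_card h₃)

end WeightedDigraph

/-! ## Minimum cuts by pushing single units of flow

The digraphs in this section have the edges `0, …, m - 1` with the tails `tl e` and the heads
`hd e`; all edges have unit capacity. -/

namespace UnitFlow

open Finset

/-- The number of edges that leave `A`. -/
def cutCard (m : ℕ) (tl hd : ℕ → ℕ) (A : Finset ℕ) : ℕ :=
  #{e ∈ range m | tl e ∈ A ∧ hd e ∉ A}

/-- The inflow minus the outflow of `f` at `v`. -/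
def excess (m : ℕ) (tl hd : ℕ → ℕ) (f : ℕ → ℕ) (v : ℕ) : ℤ :=
  ∑ e ∈ range m, (f e : ℤ) * ((if hd e = v then 1 else 0) - (if tl e = v then 1 else 0))

variable {N m a b cur : ℕ} {tl hd f h : ℕ → ℕ}

/-- Exchanging the sums makes edges inside `A` cancel, leaving only those that cross its boundary.
-/
theorem sum_excess (A : Finset ℕ) :
    ∑ v ∈ A, excess m tl hd f v =
      ∑ e ∈ range m, (f e : ℤ) * ((if hd e ∈ A then 1 else 0) - (if tl e ∈ A then 1 else 0)) := by
  simp only [excess]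
  rw [sum_comm]
  refine sum_congr rfl fun e _ => ?_
  rw [← mul_sum, sum_sub_distrib, sum_ite_eq, sum_ite_eq]

theorem cutCard_eq_sum (A : Finset ℕ) :
    (cutCard m tl hd A : ℤ) = ∑ e ∈ range m, if tl e ∈ A ∧ hd e ∉ A then 1 else 0 := by
  rw [cutCard, card_filter]
  push_cast
  rfl

/-- Weak duality: the net outflow of `A` is at most its number of outgoing edges. -/
theorem neg_sum_excess_le (hf : ∀ e < m, f e ≤ 1) (A : Finset ℕ) :
    -∑ v ∈ A, excess m tl hd f v ≤ cutCard m tl hd A := by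
  rw [sum_excess, cutCard_eq_sum, ← sum_neg_distrib]
  refine sum_le_sum fun e he => ?_
  have := hf e (mem_range.1 he)
  have h₀ : (0 : ℤ) ≤ f e := by positivity
  have h₁ : (f e : ℤ) ≤ 1 := by exact_mod_cast this
  by_cases h₂ : tl e ∈ A <;> by_cases h₃ : hd e ∈ A <;> simp [h₂, h₃, h₁]

/-- Complementary slackness: equality holds when no residual edge leaves `A`, so outgoing edges are
full and incoming edges empty. -/
theorem neg_sum_excess_eq {A : Finset ℕ} (hf : ∀ e < m, f e ≤ 1)
    (h₀ : ∀ e < m, f e = 0 → tl e ∈ A → hd e ∈ A)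
    (h₁ : ∀ e < m, f e = 1 → hd e ∈ A → tl e ∈ A) :
    -∑ v ∈ A, excess m tl hd f v = cutCard m tl hd A := by
  rw [sum_excess, cutCard_eq_sum, ← sum_neg_distrib]
  refine sum_congr rfl fun e he => ?_
  have hem := mem_range.1 he
  have h₂ := h₀ e hem
  have h₃ := h₁ e hem
  rcases Nat.le_one_iff_eq_zero_or_eq_one.1 (hf e hem) with h | h
  · by_cases h₄ : tl e ∈ A <;> by_cases h₅ : hd e ∈ A <;> simp_all
  · by_cases h₄ : tl e ∈ A <;> by_cases h₅ : hd e ∈ A <;> simp_all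

theorem excess_update {e : ℕ} (he : e < m) (x v : ℕ) :
    excess m tl hd (Function.update f e x) v = excess m tl hd f v +
      ((x : ℤ) - f e) * ((if hd e = v then 1 else 0) - (if tl e = v then 1 else 0)) := by
  have hme := mem_range.2 he
  simp only [excess]
  rw [← add_sum_erase _ _ hme, ← add_sum_erase (range m) (fun e => (f e : ℤ) * _) hme,
    Function.update_self]
  rw [sum_congr rfl (g := fun e => (f e : ℤ) *
    ((if hd e = v then 1 else 0) - (if tl e = v then 1 else 0)))]
  · ring
  · intro d hd
    rw [Function.update_of_ne (ne_of_mem_erase hd)]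

theorem excess_le (hf : ∀ e < m, f e ≤ 1) (v : ℕ) : excess m tl hd f v ≤ m := by
  have : (m : ℤ) = ∑ e ∈ range m, 1 := by simp
  rw [this, excess]
  refine sum_le_sum fun e he => ?_
  have h₀ : (0 : ℤ) ≤ f e := by positivity
  have h₁ : (f e : ℤ) ≤ 1 := by exact_mod_cast hf e (mem_range.1 he)
  split_ifs <;> (simp; try linarith)

/-! ### Preflows with a single unit in transit -/

/-- A flow from `a` to `b` together with a unit of flow on its way at `cur`, and a labelling `h` of
the vertices that decreases by at most `1` along the residual edges. -/
structure IsPreflow (N m : ℕ) (tl hd : ℕ → ℕ) (a b : ℕ) (f h : ℕ → ℕ) (cur : ℕ) : Prop where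
  le_one : ∀ e < m, f e ≤ 1
  label_tl : ∀ e < m, f e = 0 → h (tl e) ≤ h (hd e) + 1
  label_hd : ∀ e < m, f e = 1 → h (hd e) ≤ h (tl e) + 1
  excess_eq : ∀ v, v ≠ a → v ≠ b → excess m tl hd f v = if v = cur then 1 else 0
  label_sink : h b = 0
  label_le : ∀ v, h v ≤ N
  cur_lt : cur < N

/-- The unit of flow at `cur` can be pushed along the edge `e` to a vertex with a smaller label. -/
def Admissible (tl hd f h : ℕ → ℕ) (cur e : ℕ) : Prop :=
  (f e = 0 ∧ tl e = cur ∧ h (hd e) < h cur) ∨ (f e = 1 ∧ hd e = cur ∧ h (tl e) < h cur)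

/-- The measure of progress: it increases with every push, relabelling and arrival. -/
def potential (N m : ℕ) (tl hd : ℕ → ℕ) (b : ℕ) (f h : ℕ → ℕ) (cur : ℕ) : ℤ :=
  2 * ∑ v ∈ range N, (h v : ℤ) - h cur +
    (N + 1) * (excess m tl hd f b - if b = cur then 1 else 0)

theorem isPreflow_zero (ha : a < N) : IsPreflow N m tl hd a b (fun _ => 0) (fun _ => 0) a where
  le_one := by simp
  label_tl := by simp
  label_hd := by simp
  excess_eq v hv _ := by simp [excess, hv]
  label_sink := rfl
  label_le := by simp
  cur_lt := ha

theorem potential_zero (hab : a ≠ b) :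
    potential N m tl hd b (fun _ => 0) (fun _ => 0) a = 0 := by
  simp [potential, excess, hab.symm]

theorem IsPreflow.potential_le (H : IsPreflow N m tl hd a b f h cur) :
    potential N m tl hd b f h cur ≤ 2 * (N * N) + (N + 1) * m := by
  have h₁ : ∑ v ∈ range N, (h v : ℤ) ≤ N * N := by
    calc ∑ v ∈ range N, (h v : ℤ) ≤ ∑ v ∈ range N, (N : ℤ) :=
          sum_le_sum fun v _ => by exact_mod_cast H.label_le v
      _ = N * N := by simp
  have h₂ : (excess m tl hd f b - if b = cur then 1 else 0) ≤ (m : ℤ) := by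
    have := excess_le (tl := tl) (hd := hd) H.le_one b
    split_ifs <;> linarith
  have h₃ := mul_le_mul_of_nonneg_left h₂ (by positivity : (0 : ℤ) ≤ N + 1)
  have h₄ : (0 : ℤ) ≤ h cur := by positivity
  rw [potential]
  linarith

/-- The next unit of flow starts at the source. -/
theorem IsPreflow.restart (H : IsPreflow N m tl hd a b f h b) (ha : a < N) :
    IsPreflow N m tl hd a b f h a :=
  { H with
    excess_eq := fun v hva hvb => by simpa [hva, hvb] using H.excess_eq v hva hvb
    cur_lt := ha }

/-- An arrival is worth `N + 1`, which outweighs the loss of at most `N` from moving from label `0`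
to the label of `a`. -/
theorem IsPreflow.potential_restart (H : IsPreflow N m tl hd a b f h b) (hab : a ≠ b) :
    potential N m tl hd b f h b < potential N m tl hd b f h a := by
  have : (h a : ℤ) ≤ N := by exact_mod_cast H.label_le a
  simp only [potential, H.label_sink, if_neg hab.symm, if_true, Nat.cast_zero]
  linarith

/-- Without an admissible edge, every residual edge out of `cur` leads to a label at least `h cur`,
so there is room to raise `h cur` by one. -/
theorem IsPreflow.relabel (H : IsPreflow N m tl hd a b f h cur) (hcur : cur ≠ b)
    (hN : h cur < N) (hadm : ∀ e < m, ¬ Admissible tl hd f h cur e) :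
    IsPreflow N m tl hd a b f (Function.update h cur (h cur + 1)) cur where
  le_one := H.le_one
  label_tl e he hf := by
    have h₁ := H.label_tl e he hf
    have h₂ := hadm e he
    simp only [Admissible, not_or, not_and, not_lt] at h₂
    have h₃ := h₂.1 hf
    simp only [Function.update_apply]
    split_ifs with h₄ h₅ h₅
    · omega
    · have := h₃ h₄; omega
    · rw [h₅] at h₁; omega
    · exact h₁
  label_hd e he hf := by
    have h₁ := H.label_hd e he hf
    have h₂ := hadm e he
    simp only [Admissible, not_or, not_and, not_lt] at h₂
    have h₃ := h₂.2 hf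
    simp only [Function.update_apply]
    split_ifs with h₄ h₅ h₅
    · omega
    · have := h₃ h₄; omega
    · rw [h₅] at h₁; omega
    · exact h₁
  excess_eq := H.excess_eq
  label_sink := by rw [Function.update_of_ne hcur.symm, H.label_sink]
  label_le v := by
    rw [Function.update_apply]
    split_ifs
    · exact hN
    · exact H.label_le v
  cur_lt := H.cur_lt

/-- The raised label counts twice in the sum and is subtracted once, for a net gain of one. -/
theorem IsPreflow.potential_relabel (H : IsPreflow N m tl hd a b f h cur) :
    potential N m tl hd b f h cur <
      potential N m tl hd b f (Function.update h cur (h cur + 1)) cur := by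
  have hc := mem_range.2 H.cur_lt
  have : ∑ v ∈ range N, ((Function.update h cur (h cur + 1) v : ℕ) : ℤ) =
      ∑ v ∈ range N, (h v : ℤ) + 1 := by
    rw [← add_sum_erase _ _ hc, ← add_sum_erase (range N) (fun v => (h v : ℤ)) hc,
      Function.update_self, sum_congr rfl (g := fun v => (h v : ℤ))]
    · push_cast; ring
    · intro v hv
      rw [Function.update_of_ne (ne_of_mem_erase hv)]
  simp only [potential, this, Function.update_self]
  push_cast
  linarith

theorem IsPreflow.pushForward (H : IsPreflow N m tl hd a b f h cur) {e : ℕ} (he : e < m)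
    (hf : f e = 0) (ht : tl e = cur) (hh : h (hd e) < h cur) (hN : hd e < N) :
    IsPreflow N m tl hd a b (Function.update f e 1) h (hd e) ∧
      potential N m tl hd b f h cur < potential N m tl hd b (Function.update f e 1) h (hd e) := by
  -- Excess and position of the unit move together, so their difference is invariant. The potential
  -- then changes only through `h cur`, which drops by exactly one because labels fall by at most
  -- one along residual edges.
  have hg : ∀ v, excess m tl hd (Function.update f e 1) v - (if v = hd e then 1 else 0) =
      excess m tl hd f v - (if v = cur then 1 else 0) := by
    intro v
    rw [excess_update he, hf, ht]
    simp only [eq_comm (a := v)]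
    push_cast
    ring
  have hl := H.label_tl e he hf
  rw [ht] at hl
  refine ⟨⟨?_, ?_, ?_, ?_, H.label_sink, H.label_le, hN⟩, ?_⟩
  · intro d hd
    rw [Function.update_apply]
    split_ifs
    · exact le_rfl
    · exact H.le_one d hd
  · intro d hd hfd
    rw [Function.update_apply] at hfd
    split_ifs at hfd
    exact H.label_tl d hd hfd
  · intro d hd hfd
    rw [Function.update_apply] at hfd
    split_ifs at hfd with hde
    · subst hde; rw [ht]; omega
    · exact H.label_hd d hd hfd
  · intro v hva hvb
    have h₁ := hg v
    rw [H.excess_eq v hva hvb] at h₁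
    linarith
  · simp only [potential, hg]
    have : (h cur : ℤ) = h (hd e) + 1 := by exact_mod_cast (by omega : h cur = h (hd e) + 1)
    linarith

theorem IsPreflow.pushBackward (H : IsPreflow N m tl hd a b f h cur) {e : ℕ} (he : e < m)
    (hf : f e = 1) (ht : hd e = cur) (hh : h (tl e) < h cur) (hN : tl e < N) :
    IsPreflow N m tl hd a b (Function.update f e 0) h (tl e) ∧
      potential N m tl hd b f h cur < potential N m tl hd b (Function.update f e 0) h (tl e) := by
  have hg : ∀ v, excess m tl hd (Function.update f e 0) v - (if v = tl e then 1 else 0) =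
      excess m tl hd f v - (if v = cur then 1 else 0) := by
    intro v
    rw [excess_update he, hf, ht]
    simp only [eq_comm (a := v)]
    push_cast
    ring
  have hl := H.label_hd e he hf
  rw [ht] at hl
  refine ⟨⟨?_, ?_, ?_, ?_, H.label_sink, H.label_le, hN⟩, ?_⟩
  · intro d hd
    rw [Function.update_apply]
    split_ifs
    · exact Nat.zero_le _
    · exact H.le_one d hd
  · intro d hd hfd
    rw [Function.update_apply] at hfd
    split_ifs at hfd with hde
    · subst hde; rw [ht]; omega
    · exact H.label_tl d hd hfd
  · intro d hd hfd
    rw [Function.update_apply] at hfd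
    split_ifs at hfd
    exact H.label_hd d hd hfd
  · intro v hva hvb
    have h₁ := hg v
    rw [H.excess_eq v hva hvb] at h₁
    linarith
  · simp only [potential, hg]
    have : (h cur : ℤ) = h (tl e) + 1 := by exact_mod_cast (by omega : h cur = h (tl e) + 1)
    linarith

/-- A gap in the labels below `h cur` yields a minimum cut. -/
theorem IsPreflow.cutCard_le (H : IsPreflow N m tl hd a b f h cur)
    (htl : ∀ e < m, tl e < N) (hhd : ∀ e < m, hd e < N) {k : ℕ} (hk : 0 < k) (hkc : k ≤ h cur)
    (hgap : ∀ v < N, h v ≠ k) :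
    a ∈ {v ∈ range N | k ≤ h v} ∧ b ∉ {v ∈ range N | k ≤ h v} ∧
      ∀ B : Finset ℕ, a ∈ B → b ∉ B →
        cutCard m tl hd {v ∈ range N | k ≤ h v} ≤ cutCard m tl hd B := by
  set A : Finset ℕ := {v ∈ range N | k ≤ h v} with hA
  have hb : b ∉ A := by
    simp only [hA, mem_filter, H.label_sink]
    omega
  have hcur : cur ∈ A := by simp [hA, H.cur_lt, hkc]
  -- With no vertex labelled `k`, a residual edge leaving `A` would go from a label above `k` to one
  -- below `k`, a drop of at least two.
  have heq : -∑ v ∈ A, excess m tl hd f v = cutCard m tl hd A := by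
    refine neg_sum_excess_eq H.le_one ?_ ?_
    · intro e he hf h₁
      simp only [hA, mem_filter, mem_range] at h₁ ⊢
      have h₂ := H.label_tl e he hf
      have h₃ := hgap _ (htl e he)
      exact ⟨hhd e he, by omega⟩
    · intro e he hf h₁
      simp only [hA, mem_filter, mem_range] at h₁ ⊢
      have h₂ := H.label_hd e he hf
      have h₃ := hgap _ (hhd e he)
      exact ⟨htl e he, by omega⟩
  -- Away from `a` and `b` the only excess is the unit at `cur`, so for sets avoiding `b` the sum
  -- depends only on whether they contain `a` and `cur`.
  have hsum : ∀ B : Finset ℕ, b ∉ B → ∑ v ∈ B, excess m tl hd f v =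
      (if a ∈ B then excess m tl hd f a - (if a = cur then 1 else 0) else 0) +
        if cur ∈ B then 1 else 0 := by
    intro B hbB
    have h₁ : ∑ v ∈ B, (excess m tl hd f v - (if v = cur then 1 else 0)) =
        if a ∈ B then excess m tl hd f a - (if a = cur then 1 else 0) else 0 := by
      rw [← sum_ite_eq' B a fun v => excess m tl hd f v - (if v = cur then 1 else 0)]
      refine sum_congr rfl fun v hv => ?_
      by_cases h₂ : v = a
      · rw [if_pos h₂]
      · rw [if_neg h₂, H.excess_eq v h₂ (fun h => hbB (h ▸ hv)), sub_self]
    rw [← h₁, sum_sub_distrib, sum_ite_eq']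
    ring
  -- Otherwise the net outflow of `A` would be `-1`, yet it equals the size of a cut.
  have ha : a ∈ A := by
    by_contra ha
    have := hsum A hb
    rw [if_neg ha, if_pos hcur] at this
    have h₂ : (0 : ℤ) ≤ cutCard m tl hd A := by positivity
    linarith
  refine ⟨ha, hb, fun B haB hbB => ?_⟩
  have h₁ := hsum A hb
  have h₂ := hsum B hbB
  have h₃ := neg_sum_excess_le (tl := tl) (hd := hd) H.le_one B
  rw [if_pos ha, if_pos hcur] at h₁
  rw [if_pos haB] at h₂
  -- The unit in transit does no harm: it lies in `A`, so it lowers the outflow of `A` by at least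
  -- as much as that of `B`.
  have h₄ : (if cur ∈ B then (1 : ℤ) else 0) ≤ 1 := by split_ifs <;> simp
  have : (cutCard m tl hd A : ℤ) ≤ cutCard m tl hd B := by linarith
  exact_mod_cast this

/-- If the labels `0, …, k - 1` are all in use, then `k` is at most the number of vertices. -/
theorem le_of_forall_exists_label {k : ℕ} (hlab : ∀ j < k, ∃ v < N, h v = j) : k ≤ N := by
  have : range k ⊆ (range N).image h := fun j hj => by
    obtain ⟨v, hv, hj⟩ := hlab j (mem_range.1 hj)
    exact mem_image.2 ⟨v, mem_range.2 hv, hj⟩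
  simpa using (card_le_card this).trans card_image_le

end UnitFlow

/-! ## The Bellman–Ford algorithm -/

namespace WeightedDigraph

variable {n m : ℕ} {G : WeightedDigraph n m} {s t u v : Fin n} {P q : List (Fin m)}

/-- After `k` rounds and the first `i` edges of the next round, with the initial labels `c`: every
label is attained by a walk, and walks of at most `k` edges, or with one more edge among the first
`i` edges, have been taken into account. -/
structure Relaxed (G : WeightedDigraph n m) (c : Fin n → ℝ) (d : Fin n → ℝ) (k i : ℕ) : Prop where
  attained : ∀ v, ∃ u q, G.IsWalk u q v ∧ d v = c u + G.length q
  le : ∀ u q v, G.IsWalk u q v → q.length ≤ k → d v ≤ c u + G.length q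
  le_head : ∀ e : Fin m, e < i → ∀ u q, G.IsWalk u q (G.tail e) → q.length ≤ k →
    d (G.head e) ≤ c u + G.length q + G.weight e

variable {c d d' : Fin n → ℝ} {k i : ℕ}

theorem relaxed_zero (c : Fin n → ℝ) : G.Relaxed c c 0 0 where
  attained v := ⟨v, [], rfl, by simp [length_nil]⟩
  le u q v hq hk := by
    obtain rfl : q = [] := List.length_eq_zero_iff.1 (by omega)
    obtain rfl : u = v := hq
    simp [length_nil]
  le_head e he := absurd he (by omega)

/-- Treats both outcomes of an edge relaxation at once. Labels are updated in place, so they may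
already reflect longer walks; only the upper bounds are tied to `k` and `i`. -/
theorem Relaxed.of_le (H : G.Relaxed c d k i) {e : Fin m} (hi : (e : ℕ) = i)
    (hle : ∀ v, d' v ≤ d v)
    (hatt : ∀ v, d' v = d v ∨ v = G.head e ∧ d' v = d (G.tail e) + G.weight e)
    (hhead : d' (G.head e) ≤ d (G.tail e) + G.weight e) : G.Relaxed c d' k (i + 1) where
  attained v := by
    rcases hatt v with h | ⟨rfl, h⟩
    · rw [h]; exact H.attained v
    · obtain ⟨u, q, hq, hd⟩ := H.attained (G.tail e)
      refine ⟨u, q ++ [e], hq.append ⟨rfl, rfl⟩, ?_⟩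
      rw [h, hd, length_append, length_cons, length_nil]
      ring
  le u q v hq hk := (hle v).trans (H.le u q v hq hk)
  le_head f hf u q hq hk := by
    rcases Nat.lt_succ_iff_lt_or_eq.1 hf with hf | hf
    · exact (hle _).trans (H.le_head f hf u q hq hk)
    · obtain rfl : f = e := Fin.ext (by omega)
      linarith [H.le u q _ hq hk]

theorem Relaxed.of_not_lt (H : G.Relaxed c d k i) {e : Fin m} (hi : (e : ℕ) = i)
    (h : d (G.head e) ≤ d (G.tail e) + G.weight e) : G.Relaxed c d k (i + 1) :=
  H.of_le hi (fun _ => le_rfl) (fun _ => .inl rfl) h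

theorem Relaxed.update (H : G.Relaxed c d k i) {e : Fin m} (hi : (e : ℕ) = i)
    (h : d (G.tail e) + G.weight e < d (G.head e)) :
    G.Relaxed c (Function.update d (G.head e) (d (G.tail e) + G.weight e)) k (i + 1) := by
  refine H.of_le hi (fun v => ?_) (fun v => ?_) (by rw [Function.update_self])
  · rw [Function.update_apply]
    split_ifs with hv
    · rw [hv]; exact h.le
    · exact le_rfl
  · by_cases hv : v = G.head e
    · exact .inr ⟨hv, by rw [hv, Function.update_self]⟩
    · exact .inl (Function.update_of_ne hv _ _)

/-- A walk with one more edge is a walk counted before followed by its last edge, which the finished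
round has relaxed. -/
theorem Relaxed.succ (H : G.Relaxed c d k m) : G.Relaxed c d (k + 1) 0 where
  attained := H.attained
  le u q v hq hk := by
    rcases q.eq_nil_or_concat with rfl | ⟨r, e, rfl⟩
    · exact H.le u [] v hq (Nat.zero_le _)
    · rw [List.concat_eq_append] at *
      obtain ⟨y, hy, he, hv⟩ := isWalk_append.1 hq
      obtain rfl : G.head e = v := hv
      subst he
      rw [length_append, length_cons, length_nil]
      have := H.le_head e e.2 u r hy (by simpa using hk)
      linarith
  le_head e he := absurd he (by omega)

/-- The walk attaining the label of the tail, extended by the edge, shortens to a path; paths have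
fewer than `n` edges and have been taken into account. -/
theorem Relaxed.isPotential (H : G.Relaxed c d n i) : G.IsPotential d := by
  intro e
  obtain ⟨u, q, hq, hd⟩ := H.attained (G.tail e)
  obtain ⟨r, hr, hl⟩ := (hq.append (q := [e]) ⟨rfl, rfl⟩).exists_isPath
  have := H.le u r _ hr.1 hr.length_lt.le
  rw [length_append, length_cons, length_nil] at hl
  linarith

/-- The initial labels: the length of the given shortest path serves as infinity. -/
noncomputable def initLabel (G : WeightedDigraph n m) (s : Fin n) (P : List (Fin m))
    (v : Fin n) : ℝ :=
  if v = s then 0 else G.length P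

theorem Relaxed.apply_source (H : G.Relaxed (G.initLabel s P) d k i) : d s = 0 := by
  apply le_antisymm
  · simpa [initLabel, length_nil] using H.le s [] s rfl (Nat.zero_le _)
  · obtain ⟨u, q, -, hd⟩ := H.attained s
    rw [hd]
    refine add_nonneg ?_ (length_nonneg q)
    rw [initLabel]
    split_ifs
    · exact le_rfl
    · exact length_nonneg P

/-- A walk attaining `d t` either starts at `s`, hence is no shorter than `P`, or starts elsewhere
with an initial label that already equals the length of `P`. -/
theorem Relaxed.apply_sink (hP : G.IsShortestPath s t P)
    (H : G.Relaxed (G.initLabel s P) d n i) : d t = G.length P := by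
  apply le_antisymm
  · simpa [initLabel] using H.le s P t hP.1.1 hP.1.length_lt.le
  · obtain ⟨u, q, hq, hd⟩ := H.attained t
    rw [hd, initLabel]
    split_ifs with hu
    · obtain ⟨r, hr, hl⟩ := hq.exists_isPath
      rw [hu] at hr
      linarith [hP.2 r hr]
    · linarith [length_nonneg (G := G) q]

end WeightedDigraph

/-! ## The program -/

namespace RAM

/-- The test `x < y`. -/
def Test.natLt (x y : NExpr) : Test := .neg (.natLe y x)

theorem Test.holds_natLt {σ : State} {x y : NExpr} :
    (Test.natLt x y).Holds σ ↔ x.eval σ < y.eval σ := by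
  simp [Test.natLt, Test.Holds]

/-- The input `G, s, t, P` is in its place. -/
structure Loaded {n m : ℕ} (G : WeightedDigraph n m) (s t : Fin n) (P : List (Fin m))
    (σ : State) : Prop where
  nat : ∀ a < 4, σ.nat a = (inputState G s t P).nat a
  real : σ.real 0 = (inputState G s t P).real 0

namespace Loaded

variable {n m : ℕ} {G : WeightedDigraph n m} {s t : Fin n} {P : List (Fin m)} {σ τ : State}

theorem frame (H : Loaded G s t P σ) {c : Program} (h : Frame c σ τ)
    (hn : ∀ a < 4, a ∉ c.natTargets) (hr : 0 ∉ c.realTargets) : Loaded G s t P τ :=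
  ⟨fun a ha => (h.nat a (hn a ha)).trans (H.nat a ha), (h.real 0 hr).trans H.real⟩

theorem vertices (H : Loaded G s t P σ) : σ.nat 0 0 = n := by
  rw [H.nat 0 (by norm_num)]; rfl

theorem edges (H : Loaded G s t P σ) : σ.nat 0 1 = m := by
  rw [H.nat 0 (by norm_num)]; rfl

theorem source (H : Loaded G s t P σ) : σ.nat 0 2 = s := by
  rw [H.nat 0 (by norm_num)]; rfl

theorem pathLength (H : Loaded G s t P σ) : σ.nat 0 4 = P.length := by
  rw [H.nat 0 (by norm_num)]; rfl

theorem tail (H : Loaded G s t P σ) (e : Fin m) : σ.nat 1 e = G.tail e := by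
  rw [H.nat 1 (by norm_num)]; simp [inputState]

theorem head (H : Loaded G s t P σ) (e : Fin m) : σ.nat 2 e = G.head e := by
  rw [H.nat 2 (by norm_num)]; simp [inputState]

theorem path (H : Loaded G s t P σ) {i : ℕ} (hi : i < P.length) : σ.nat 3 i = P[i] := by
  rw [H.nat 3 (by norm_num)]; simp [inputState, hi]

theorem weight (H : Loaded G s t P σ) (e : Fin m) : σ.real 0 e = G.weight e := by
  rw [H.real]; simp [inputState]

end Loaded

/-- The registers: cells of the array `5`. -/
def reg (i : ℕ) : NExpr := .get 5 (.const i)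

/-- The numbers in the array `0`. -/
def param (i : ℕ) : NExpr := .get 0 (.const i)

/-- Assignment to a register. -/
def setReg (i : ℕ) (x : NExpr) : Program := .setNat 5 (.const i) x

/-- Incrementation of a register. -/
def incReg (i : ℕ) : Program := setReg i (.add (reg i) (.const 1))

def markPathBody : Program :=
  .seq (.setReal 2 (.const 0) (.add (.get 2 (.const 0)) (.get 0 (.get 3 (reg 0)))))
    (.seq (.setNat 9 (.get 3 (reg 0)) (.const 1))
      (.seq (.setNat 6 (.get 2 (.get 3 (reg 0))) (.const 1)) (incReg 0)))

/-- Marks the edges of the path in the array `9` and its vertices in the array `6`, and computes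
its length. -/
def markPath : Program :=
  .seq (setReg 0 (.const 0))
    -- The loop marks heads of path edges only, so `s` is marked separately.
    (.seq (.loop (.natLt (reg 0) (param 4)) markPathBody) (.setNat 6 (param 2) (.const 1)))

def initLabelsBody : Program :=
  .seq (.setReal 1 (reg 0) (.get 2 (.const 0))) (incReg 0)

/-- Writes the initial labels to the real array `1`. -/
def initLabels : Program :=
  .seq (setReg 0 (.const 0))
    (.seq (.loop (.natLt (reg 0) (param 0)) initLabelsBody)
      -- The machine has no real constants; zero is obtained as a difference of equal numbers.
      (.setReal 1 (param 2) (.sub (.get 1 (param 2)) (.get 1 (param 2)))))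

/-- The label of the tail of the edge in register `0`, plus the weight of this edge. -/
def tailLabel : RExpr := .add (.get 1 (.get 1 (reg 0))) (.get 0 (reg 0))

/-- The label of the head of the edge in register `0`. -/
def headLabel : RExpr := .get 1 (.get 2 (reg 0))

/-- Register `0` counts edges and register `1` rounds. The nested loops are merged into one, so that
the body is loop-free as `halts_loop` requires. -/
def relaxBody : Program :=
  .branch (.natLt (reg 0) (param 1))
    (.seq (.branch (.realLe headLabel tailLabel) .skip (.setReal 1 (.get 2 (reg 0)) tailLabel))
      (incReg 0))
    (.seq (incReg 1) (setReg 0 (.const 0)))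

/-- The Bellman–Ford algorithm. -/
def relax : Program :=
  .seq (setReg 0 (.const 0)) (.seq (setReg 1 (.const 0))
    (.loop (.natLt (reg 1) (param 0)) relaxBody))

def contractBody : Program :=
  .seq
    (.branch (.conj (.realLe tailLabel headLabel) (.natLe (.get 9 (reg 0)) (.const 0)))
      (.seq
        (.branch (.natLe (.get 6 (.get 1 (reg 0))) (.const 0))
          (.setNat 10 (reg 0) (.get 1 (reg 0))) (.setNat 10 (reg 0) (param 0)))
        (.branch (.natLe (.get 6 (.get 2 (reg 0))) (.const 0))
          (.setNat 11 (reg 0) (.get 2 (reg 0)))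
          (.setNat 11 (reg 0) (.add (param 0) (.const 1)))))
      (.seq (.setNat 10 (reg 0) (param 0)) (.setNat 11 (reg 0) (param 0))))
    (incReg 0)

/-- Writes the tails and the heads after the contraction to the arrays `10` and `11`. -/
def contract : Program :=
  .seq (setReg 0 (.const 0)) (.loop (.natLt (reg 0) (param 1)) contractBody)

/-- Pushes the unit of flow forward along the edge in register `0`. -/
def pushForward : Program :=
  .seq (.setNat 7 (reg 0) (.const 1))
    (.seq (setReg 1 (.get 11 (reg 0))) (setReg 0 (.const 0)))

/-- Pushes the unit of flow backward along the edge in register `0`. -/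
def pushBackward : Program :=
  .seq (.setNat 7 (reg 0) (.const 0))
    (.seq (setReg 1 (.get 10 (reg 0))) (setReg 0 (.const 0)))

/-- The test for equality. -/
def Test.natEq (x y : NExpr) : Test := .conj (.natLe x y) (.natLe y x)

theorem Test.holds_natEq {σ : State} {x y : NExpr} :
    (Test.natEq x y).Holds σ ↔ x.eval σ = y.eval σ := by
  simp only [Test.natEq, Test.Holds]
  omega

/-- The number of vertices after the contraction. -/
def cutVertices : NExpr := .add (param 0) (.const 2)

/-- The search for an admissible edge is interleaved with the moves: register `0` scans one edge per
turn and is reset by every restart, relabelling or push. Register `1` holds the position of the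
unit. -/
def flowBody : Program :=
  .branch (.natEq (reg 1) (.add (param 0) (.const 1)))
    (.seq (setReg 1 (param 0)) (setReg 0 (.const 0)))
    (.branch (.natLe (param 1) (reg 0))
      (.seq (.setNat 8 (reg 1) (.add (.get 8 (reg 1)) (.const 1))) (setReg 0 (.const 0)))
      (.branch
        (.conj (.natEq (.get 7 (reg 0)) (.const 0))
          (.conj (.natEq (.get 10 (reg 0)) (reg 1))
            (.natLt (.get 8 (.get 11 (reg 0))) (.get 8 (reg 1)))))
        pushForward
        (.branch
          (.conj (.natEq (.get 7 (reg 0)) (.const 1))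
            (.conj (.natEq (.get 11 (reg 0)) (reg 1))
              (.natLt (.get 8 (.get 10 (reg 0))) (.get 8 (reg 1)))))
          pushBackward
          (incReg 0))))

/-- Computes a maximum flow in the array `7` and labels in the array `8`. -/
def flow : Program :=
  .seq (setReg 1 (param 0)) (.seq (setReg 0 (.const 0))
    (.loop (.natLt (.get 8 (reg 1)) cutVertices) flowBody))

def gapBody : Program :=
  .branch (.natEq (.get 8 (reg 0)) (reg 1)) (.seq (incReg 1) (setReg 0 (.const 0))) (incReg 0)

/-- Finds the least positive number that is not a label. -/
def gap : Program :=
  .seq (setReg 1 (.const 1)) (.seq (setReg 0 (.const 0))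
    (.loop (.natLt (reg 0) cutVertices) gapBody))

def outputCutBody : Program :=
  .seq
    (.branch (.conj (.natLe (reg 1) (.get 8 (.get 10 (reg 0))))
        (.natLt (.get 8 (.get 11 (reg 0))) (reg 1)))
      (.setNat 4 (reg 0) (.const 1)) (.setNat 4 (reg 0) (.const 0)))
    (incReg 0)

/-- Writes the indicator vector of the cut. -/
def outputCut : Program :=
  .seq (setReg 0 (.const 0)) (.loop (.natLt (reg 0) (param 1)) outputCutBody)

/-- The program for minimum anti-forcing sets. -/
def antiForcing : Program :=
  .seq markPath (.seq initLabels (.seq relax (.seq contract (.seq flow (.seq gap outputCut)))))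

end RAM

/-! ## Correctness of the program -/

namespace RAM

theorem Halts.setReg_seq {σ : State} {i T U : ℕ} {x : NExpr} {d : Program} {R : State → Prop}
    (hT : x.cost + 2 + U ≤ T) (h : Halts d (σ.setNat 5 i (x.eval σ)) U R) :
    Halts (.seq (setReg i x) d) σ T R :=
  (Program.LoopFree.halts (c := setReg i x) (Q := (· = σ.setNat 5 i (x.eval σ)))
    (T := x.cost + 2) trivial (by simp only [Program.cost, setReg, NExpr.cost]; omega) rfl).seq
    hT fun τ _ hτ => by subst hτ; exact h

variable {n m : ℕ} {G : WeightedDigraph n m} {s t : Fin n} {P : List (Fin m)} {σ τ : State}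

theorem Loaded.setNat (H : Loaded G s t P σ) {a : ℕ} (ha : 4 ≤ a) (i v : ℕ) :
    Loaded G s t P (σ.setNat a i v) :=
  ⟨fun b hb => by rw [State.nat_setNat_of_ne _ _ _ (by omega)]; exact H.nat b hb, H.real⟩

theorem le_pow_four {x y : ℕ} (h : x ≤ y) : x ≤ y ^ 4 :=
  h.trans (Nat.le_self_pow (by norm_num) y)

theorem update_val_apply {α : Type*} (a : ℕ → α) (i j : Fin n) (x : α) :
    Function.update a (i : ℕ) x (j : ℕ) = if j = i then x else a j := by
  simp [Function.update_apply, Fin.val_inj]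

theorem halts_markPath (H : Loaded G s t P σ) (hP : G.IsPath s P t) (h₆ : σ.nat 6 = 0)
    (h₉ : σ.nat 9 = 0) (h₂ : σ.real 2 0 = 0) :
    Halts markPath σ (50 * (n + m + 3) ^ 4) (fun τ => Loaded G s t P τ ∧
      τ.real 2 0 = G.length P ∧ (∀ e : Fin m, τ.nat 9 e = 0 ↔ e ∉ P) ∧
      ∀ v : Fin n, τ.nat 6 v = 0 ↔ v ∉ s :: P.map G.head) := by
  have H₁ := H.setNat (a := 5) (by norm_num) 0 0
  have hY := le_pow_four (show n + 3 ≤ n + m + 3 by omega)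
  have hPn := hP.length_lt
  refine Halts.setReg_seq (U := 49 * (n + m + 3) ^ 4) (by simp only [NExpr.cost]; omega) ?_
  refine Halts.seq (T := 48 * (n + m + 3) ^ 4) (U := (n + m + 3) ^ 4)
    (Q := fun τ => τ.real 2 0 = G.length P ∧ (∀ e : Fin m, τ.nat 9 e = 0 ↔ e ∉ P) ∧
      ∀ v : Fin n, τ.nat 6 v = 0 ↔ v ∉ P.map G.head) ?_ ?_ ?_
  · refine halts_loop (by simp [markPathBody, incReg, setReg, Program.LoopFree])
      (fun τ => τ.nat 5 0 ≤ P.length ∧ τ.real 2 0 = G.length (P.take (τ.nat 5 0)) ∧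
        (∀ e : Fin m, τ.nat 9 e = 0 ↔ e ∉ P.take (τ.nat 5 0)) ∧
        ∀ v : Fin n, τ.nat 6 v = 0 ↔ v ∉ (P.take (τ.nat 5 0)).map G.head)
      (fun τ => P.length - τ.nat 5 0)
      (by simp [State.nat_setNat_self, State.nat_setNat_of_ne, State.real_setNat, h₆, h₉, h₂,
        WeightedDigraph.length_nil, NExpr.eval]) ?_ ?_ ?_
    · simp only [State.nat_setNat_self, NExpr.eval, Function.update_self, Program.cost, Test.cost,
        NExpr.cost, RExpr.cost, markPathBody, incReg, setReg, reg, param, Test.natLt]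
      omega
    · rintro τ hF ⟨hi, hl, he, hv⟩ hb
      have Hτ : Loaded G s t P τ := H₁.frame hF (by decide) (by decide)
      rw [Test.holds_natLt] at hb
      simp only [reg, param, NExpr.eval, Hτ.pathLength] at hb
      obtain hi : τ.nat 5 0 = P.length := by omega
      rw [hi, List.take_length] at hl he hv
      exact ⟨hl, he, hv⟩
    · rintro τ hF ⟨hi, hl, he, hv⟩ hb
      have Hτ : Loaded G s t P τ := H₁.frame hF (by decide) (by decide)
      rw [Test.holds_natLt] at hb
      simp only [reg, param, NExpr.eval, Hτ.pathLength] at hb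
      have htake : P.take (τ.nat 5 0 + 1) = P.take (τ.nat 5 0) ++ [P[τ.nat 5 0]] := by
        simp
      have hexec : markPathBody.exec τ = (((τ.setReal 2 0 (G.length (P.take (τ.nat 5 0)) +
          G.weight P[τ.nat 5 0])).setNat 9 P[τ.nat 5 0] 1).setNat 6
          (G.head P[τ.nat 5 0]) 1).setNat 5 0 (τ.nat 5 0 + 1) := by
        simp only [markPathBody, Program.exec, incReg, setReg, reg, NExpr.eval, RExpr.eval,
          State.nat_setNat_of_ne, State.nat_setReal, Hτ.path hb, Hτ.head, Hτ.weight, hl, ne_eq,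
          Nat.reduceEqDiff, not_false_eq_true]
      rw [hexec]
      generalize hi' : τ.nat 5 0 = i at *
      simp only [State.nat_setNat_self, State.nat_setNat_of_ne, State.real_setNat,
        State.nat_setReal, State.real_setReal_self, ne_eq, Nat.reduceEqDiff, not_false_eq_true,
        Function.update_self, htake]
      refine ⟨⟨hb, ?_, fun e => ?_, fun v => ?_⟩, by omega⟩
      · rw [WeightedDigraph.length_append, WeightedDigraph.length_cons,
          WeightedDigraph.length_nil, add_zero]
      · rw [update_val_apply, List.mem_append, List.mem_singleton]
        split_ifs with h
        · simp [h]
        · simp [h, he]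
      · rw [update_val_apply, List.map_append, List.mem_append]
        split_ifs with h
        · simp [h]
        · simp [h, hv]
  · omega
  · rintro τ hF ⟨hl, he, hv⟩
    have Hτ : Loaded G s t P τ := H₁.frame hF (by decide) (by decide)
    refine Program.LoopFree.halts
      (c := .setNat 6 (param 2) (.const 1)) trivial (by simp only [Program.cost, param, NExpr.cost]; omega)
      ?_
    simp only [Program.exec, param, NExpr.eval, Hτ.source, State.real_setNat,
      State.nat_setNat_self, State.nat_setNat_of_ne _ _ _ (by norm_num : 9 ≠ 6)]
    refine ⟨Hτ.setNat (by norm_num) _ _, hl, he, fun v => ?_⟩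
    rw [update_val_apply]
    split_ifs with hvs
    · simp [hvs]
    · simp [hvs, hv]

theorem halts_initLabels (H : Loaded G s t P σ) (h₂ : σ.real 2 0 = G.length P) :
    Halts initLabels σ (50 * (n + m + 3) ^ 4)
      (fun τ => ∀ v : Fin n, τ.real 1 v = G.initLabel s P v) := by
  have H₁ := H.setNat (a := 5) (by norm_num) 0 0
  have hY := le_pow_four (show n + 3 ≤ n + m + 3 by omega)
  have hs := s.2
  refine Halts.setReg_seq (U := 49 * (n + m + 3) ^ 4) (by simp only [NExpr.cost]; omega) ?_
  refine Halts.seq (T := 45 * (n + m + 3) ^ 4) (U := 4 * (n + m + 3) ^ 4)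
    (Q := fun τ => ∀ v : Fin n, τ.real 1 v = G.length P) ?_ (by omega) ?_
  · refine halts_loop (by simp [initLabelsBody, incReg, setReg, Program.LoopFree])
      (fun τ => τ.nat 5 0 ≤ n ∧ ∀ v : Fin n, v < τ.nat 5 0 → τ.real 1 v = G.length P)
      (fun τ => n - τ.nat 5 0) (by simp [State.nat_setNat_self, NExpr.eval]) ?_ ?_ ?_
    · simp only [State.nat_setNat_self, NExpr.eval, Function.update_self, Program.cost, Test.cost,
        NExpr.cost, RExpr.cost, initLabelsBody, incReg, setReg, reg, param, Test.natLt]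
      omega
    · rintro τ hF ⟨hi, hl⟩ hb v
      have Hτ : Loaded G s t P τ := H₁.frame hF (by decide) (by decide)
      rw [Test.holds_natLt] at hb
      simp only [reg, param, NExpr.eval, Hτ.vertices] at hb
      exact hl v (by omega)
    · rintro τ hF ⟨hi, hl⟩ hb
      have Hτ : Loaded G s t P τ := H₁.frame hF (by decide) (by decide)
      have hτ₂ : τ.real 2 0 = G.length P := by rw [hF.real 2 (by decide)]; exact h₂
      rw [Test.holds_natLt] at hb
      simp only [reg, param, NExpr.eval, Hτ.vertices] at hb
      simp only [initLabelsBody, Program.exec, incReg, setReg, reg, NExpr.eval, RExpr.eval,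
        State.nat_setReal, State.nat_setNat_self, State.real_setNat, State.real_setReal_self,
        Function.update_self, hτ₂]
      refine ⟨⟨hb, fun v hv => ?_⟩, by omega⟩
      rw [Function.update_apply]
      split_ifs with h
      · rfl
      · exact hl v (by omega)
  · intro τ hF hl
    have Hτ : Loaded G s t P τ := H₁.frame hF (by decide) (by decide)
    refine Program.LoopFree.halts
      (c := .setReal 1 (param 2) (.sub (.get 1 (param 2)) (.get 1 (param 2)))) trivial
      (by simp only [Program.cost, param, NExpr.cost, RExpr.cost]; omega) ?_
    simp only [Program.exec, param, NExpr.eval, RExpr.eval, Hτ.source, sub_self,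
      State.real_setReal_self]
    intro v
    rw [update_val_apply, hl, WeightedDigraph.initLabel]

/-! ### Correctness of the shortest path and contraction phases -/

theorem eval_tailLabel (H : Loaded G s t P τ) (e : Fin m) (he : τ.nat 5 0 = e) :
    tailLabel.eval τ = τ.real 1 (G.tail e) + G.weight e := by
  simp only [tailLabel, RExpr.eval, NExpr.eval, reg, he, H.tail, H.weight]

theorem eval_headLabel (H : Loaded G s t P τ) (e : Fin m) (he : τ.nat 5 0 = e) :
    headLabel.eval τ = τ.real 1 (G.head e) := by
  simp only [headLabel, RExpr.eval, NExpr.eval, reg, he, H.head]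

theorem mul_le_pow_four (n m : ℕ) : (n + 1) * (m + 1) ≤ (n + m + 3) ^ 4 := by
  calc (n + 1) * (m + 1) ≤ (n + m + 3) * (n + m + 3) := Nat.mul_le_mul (by omega) (by omega)
    _ = (n + m + 3) ^ 2 := by ring
    _ ≤ (n + m + 3) ^ 4 := Nat.pow_le_pow_right (by omega) (by norm_num)

theorem halts_relax (H : Loaded G s t P σ) (h₁ : ∀ v : Fin n, σ.real 1 v = G.initLabel s P v) :
    Halts relax σ (100 * (n + m + 3) ^ 4)
      (fun τ => G.Relaxed (G.initLabel s P) (fun v => τ.real 1 v) n 0) := by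
  have H₁ := (H.setNat (a := 5) (by norm_num) 0 0).setNat (a := 5) (by norm_num) 1 0
  have hY := le_pow_four (show n + 3 ≤ n + m + 3 by omega)
  have hnm := mul_le_pow_four n m
  refine Halts.setReg_seq (U := 99 * (n + m + 3) ^ 4) (by simp only [NExpr.cost]; omega) ?_
  refine Halts.setReg_seq (U := 98 * (n + m + 3) ^ 4) (by simp only [NExpr.cost]; omega) ?_
  refine halts_loop (by simp [relaxBody, incReg, setReg, Program.LoopFree])
    (fun τ => τ.nat 5 1 ≤ n ∧ τ.nat 5 0 ≤ m ∧ (τ.nat 5 1 = n → τ.nat 5 0 = 0) ∧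
      G.Relaxed (G.initLabel s P) (fun v => τ.real 1 v) (τ.nat 5 1) (τ.nat 5 0))
    -- A round costs `m` turns for the edges and one turn to start the next round.
    (fun τ => (n - τ.nat 5 1) * (m + 1) + (m - τ.nat 5 0)) ?_ ?_ ?_ ?_
  · simp only [State.nat_setNat_self, NExpr.eval, Function.update_self, State.real_setNat, h₁]
    simpa using WeightedDigraph.relaxed_zero _
  · have : n * (m + 1) + m + 1 ≤ (n + m + 3) ^ 4 := by
      rw [add_assoc, ← Nat.succ_mul]; exact hnm
    simp [State.nat_setNat_self, NExpr.eval, Program.cost, Test.cost,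
        NExpr.cost, RExpr.cost, relaxBody, incReg, setReg, reg, param, Test.natLt, headLabel,
        tailLabel]
    omega
  · rintro τ hF ⟨hk, hi, h0, hR⟩ hb
    have Hτ : Loaded G s t P τ := H₁.frame hF (by decide) (by decide)
    rw [Test.holds_natLt] at hb
    simp only [reg, param, NExpr.eval, Hτ.vertices] at hb
    obtain hk : τ.nat 5 1 = n := by omega
    rwa [h0 hk, hk] at hR
  · rintro τ hF ⟨hk, hi, h0, hR⟩ hb
    have Hτ : Loaded G s t P τ := H₁.frame hF (by decide) (by decide)
    rw [Test.holds_natLt] at hb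
    simp only [reg, param, NExpr.eval, Hτ.vertices] at hb
    by_cases hm : τ.nat 5 0 < m
    · obtain ⟨e, he⟩ : ∃ e : Fin m, (e : ℕ) = τ.nat 5 0 := ⟨⟨_, hm⟩, rfl⟩
      rw [relaxBody, Program.exec_branch_of_holds
        (by rw [Test.holds_natLt]; simpa [reg, param, NExpr.eval, Hτ.edges] using hm)]
      by_cases hle : τ.real 1 (G.head e) ≤ τ.real 1 (G.tail e) + G.weight e
      · rw [Program.exec, Program.exec_branch_of_holds (by
          rwa [Test.Holds, eval_tailLabel Hτ e he.symm, eval_headLabel Hτ e he.symm])]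
        simp only [Program.exec, incReg, setReg, reg, NExpr.eval, State.nat_setNat_self,
          State.real_setNat, Function.update_self, ne_eq, one_ne_zero, not_false_eq_true,
          Function.update_of_ne]
        exact ⟨⟨hk, hm, by omega, hR.of_not_lt he hle⟩, by omega⟩
      · rw [Program.exec, Program.exec_branch_of_not_holds (by
          rwa [Test.Holds, eval_tailLabel Hτ e he.symm, eval_headLabel Hτ e he.symm])]
        simp only [Program.exec, incReg, setReg, reg, NExpr.eval, State.nat_setNat_self,
          State.real_setNat, Function.update_self, ne_eq, one_ne_zero, not_false_eq_true,
          Function.update_of_ne, State.nat_setReal, State.real_setReal_self,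
          eval_tailLabel Hτ e he.symm, ← he, Hτ.head]
        rw [← he] at hR
        refine ⟨⟨hk, e.2, by omega, ?_⟩, by omega⟩
        convert hR.update rfl (not_le.1 hle) using 1
        ext v
        rw [update_val_apply, Function.update_apply]
    · obtain hi : τ.nat 5 0 = m := by omega
      rw [relaxBody, Program.exec_branch_of_not_holds
        (by rw [Test.holds_natLt]; simpa [reg, param, NExpr.eval, Hτ.edges] using hi.ge)]
      simp only [Program.exec, incReg, setReg, reg, NExpr.eval, State.nat_setNat_self,
          State.real_setNat, Function.update_self, ne_eq, one_ne_zero,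
          not_false_eq_true, Function.update_of_ne]
      rw [hi] at hR ⊢
      refine ⟨⟨hb, Nat.zero_le _, fun _ => trivial, hR.succ⟩, ?_⟩
      have : n - τ.nat 5 1 = n - (τ.nat 5 1 + 1) + 1 := by omega
      rw [this, add_mul]
      omega

theorem halts_contract {d : Fin n → ℝ} (H : Loaded G s t P σ)
    (h₁ : ∀ v : Fin n, σ.real 1 v = d v) (h₉ : ∀ e : Fin m, σ.nat 9 e = 0 ↔ e ∉ P)
    (h₆ : ∀ v : Fin n, σ.nat 6 v = 0 ↔ v ∉ s :: P.map G.head) :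
    Halts contract σ (100 * (n + m + 3) ^ 4) (fun τ => ∀ e : Fin m,
      τ.nat 10 e = G.cutTail d (s :: P.map G.head) P e ∧
      τ.nat 11 e = G.cutHead d (s :: P.map G.head) P e) := by
  have H₁ := H.setNat (a := 5) (by norm_num) 0 0
  have hY := le_pow_four (show m + 3 ≤ n + m + 3 by omega)
  refine Halts.setReg_seq (U := 99 * (n + m + 3) ^ 4) (by simp only [NExpr.cost]; omega) ?_
  refine halts_loop (by simp [contractBody, incReg, setReg, Program.LoopFree])
    (fun τ => τ.nat 5 0 ≤ m ∧ ∀ e : Fin m, e < τ.nat 5 0 →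
      τ.nat 10 e = G.cutTail d (s :: P.map G.head) P e ∧
      τ.nat 11 e = G.cutHead d (s :: P.map G.head) P e)
    (fun τ => m - τ.nat 5 0) (by simp [State.nat_setNat_self, NExpr.eval]) ?_ ?_ ?_
  · simp only [State.nat_setNat_self, NExpr.eval, Function.update_self, Program.cost, Test.cost,
      NExpr.cost, RExpr.cost, contractBody, incReg, setReg, reg, param, Test.natLt, headLabel,
      tailLabel]
    omega
  · rintro τ hF ⟨hi, hl⟩ hb e
    have Hτ : Loaded G s t P τ := H₁.frame hF (by decide) (by decide)
    rw [Test.holds_natLt] at hb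
    simp only [reg, param, NExpr.eval, Hτ.edges] at hb
    exact hl e (by omega)
  · rintro τ hF ⟨hi, hl⟩ hb
    have Hτ : Loaded G s t P τ := H₁.frame hF (by decide) (by decide)
    have hτ₁ : ∀ v : Fin n, τ.real 1 v = d v := by rw [hF.real 1 (by decide)]; exact h₁
    have hτ₉ : ∀ e : Fin m, τ.nat 9 e = 0 ↔ e ∉ P := by rw [hF.nat 9 (by decide)]; exact h₉
    have hτ₆ : ∀ v : Fin n, τ.nat 6 v = 0 ↔ v ∉ s :: P.map G.head := by
      rw [hF.nat 6 (by decide)]; exact h₆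
    rw [Test.holds_natLt] at hb
    simp only [reg, param, NExpr.eval, Hτ.edges] at hb
    obtain ⟨e, he⟩ : ∃ e : Fin m, (e : ℕ) = τ.nat 5 0 := ⟨⟨_, hb⟩, rfl⟩
    suffices h : contractBody.exec τ =
        ((τ.setNat 10 e (G.cutTail d (s :: P.map G.head) P e)).setNat 11 e
          (G.cutHead d (s :: P.map G.head) P e)).setNat 5 0 (e + 1) by
      rw [h]
      simp only [State.nat_setNat_self, State.nat_setNat_of_ne, ne_eq, Nat.reduceEqDiff,
        not_false_eq_true, Function.update_self]
      refine ⟨⟨by omega, fun f hf => ?_⟩, by omega⟩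
      rw [update_val_apply, update_val_apply]
      split_ifs with h
      · subst h; exact ⟨rfl, rfl⟩
      · exact hl f (by have := Fin.val_ne_of_ne h; omega)
    have hbranch : (Test.conj (.realLe tailLabel headLabel)
        (.natLe (.get 9 (reg 0)) (.const 0))).Holds τ ↔ G.IsTight d e ∧ e ∉ P := by
      simp only [Test.Holds, eval_tailLabel Hτ e he.symm, eval_headLabel Hτ e he.symm, hτ₁,
        NExpr.eval, reg, ← he, Nat.le_zero, hτ₉, WeightedDigraph.IsTight]
    by_cases ht : G.IsTight d e ∧ e ∉ P
    · rw [WeightedDigraph.cutTail_of_isTight ht, WeightedDigraph.cutHead_of_isTight ht,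
        contractBody, Program.exec, Program.exec_branch_of_holds (hbranch.2 ht)]
      by_cases h₁ : G.tail e ∈ s :: P.map G.head <;> by_cases h₂ : G.head e ∈ s :: P.map G.head
      all_goals
        have h₁' := hτ₆ (G.tail e)
        have h₂' := hτ₆ (G.head e)
        simp only [h₁, h₂, not_true_eq_false, not_false_eq_true, iff_true, iff_false] at h₁' h₂'
        simp [Program.exec, Test.Holds, NExpr.eval, reg, incReg, setReg, param,
          State.nat_setNat_of_ne, ← he, Hτ.tail, Hτ.head, Hτ.vertices, h₁', h₂', h₁, h₂]
    · rw [WeightedDigraph.cutTail, WeightedDigraph.cutHead, if_neg ht, if_neg ht,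
        contractBody, Program.exec, Program.exec_branch_of_not_holds (hbranch.not.2 ht)]
      simp only [Program.exec, NExpr.eval, reg, incReg, setReg, param, State.nat_setNat_of_ne,
        ne_eq, Nat.reduceEqDiff, OfNat.zero_ne_ofNat, not_false_eq_true,
        ← he, Hτ.vertices]

/-! ### Correctness and running time of the cut computation -/

open UnitFlow

/-- The source of the exponent `4`: with `y = n + m + 3`, one factor `y` bounds the turns per scan,
`3 * y ^ 2` bounds the range of the potential plus one, and `3 ≤ y` absorbs the constant. -/
theorem flow_bound (n m : ℕ) :
    (m + 1) * (2 * ((n + 2) * (n + 2)) + (n + 3) * m + 1) ≤ (n + m + 3) ^ 4 := by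
  set y := n + m + 3 with hy
  have h₁ : (n + 2) * (n + 2) ≤ y * y := Nat.mul_le_mul (by omega) (by omega)
  have h₂ : (n + 3) * m + 1 ≤ y * y := by
    calc (n + 3) * m + 1 ≤ (n + 3) * m + (n + 3) := by omega
      _ = (n + 3) * (m + 1) := by ring
      _ ≤ y * y := Nat.mul_le_mul (by omega) (by omega)
  calc (m + 1) * (2 * ((n + 2) * (n + 2)) + (n + 3) * m + 1)
      ≤ y * (3 * (y * y)) := Nat.mul_le_mul (by omega) (by omega)
    _ ≤ y * (y * (y * y)) := by gcongr; omega
    _ = y ^ 4 := by ring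

/-- The number of steps of the flow computation that are left. -/
def flowVariant (n m : ℕ) (τ : State) : ℕ :=
  ((m + 1) * (2 * ((n + 2) * (n + 2)) + (n + 3) * m -
    potential (n + 2) m (τ.nat 10) (τ.nat 11) (n + 1) (τ.nat 7) (τ.nat 8) (τ.nat 5 1)) +
    (m - τ.nat 5 0)).toNat

/-- The invariant of the flow computation. -/
structure FlowInvariant (n m : ℕ) (τ : State) : Prop where
  preflow : IsPreflow (n + 2) m (τ.nat 10) (τ.nat 11) n (n + 1) (τ.nat 7) (τ.nat 8) (τ.nat 5 1)
  le : τ.nat 5 0 ≤ m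
  not_admissible : ∀ e < τ.nat 5 0,
    ¬ Admissible (τ.nat 10) (τ.nat 11) (τ.nat 7) (τ.nat 8) (τ.nat 5 1) e

/-- Serves restart, relabelling and both pushes: a gain in potential is worth at least `m + 1`,
which pays for resetting a scan of at most `m` edges. -/
theorem flowVariant_lt {τ τ' : State} (h₁₀ : τ'.nat 10 = τ.nat 10) (h₁₁ : τ'.nat 11 = τ.nat 11)
    (hτ : FlowInvariant n m τ) (hi' : τ'.nat 5 0 = 0)
    (hτ' : IsPreflow (n + 2) m (τ.nat 10) (τ.nat 11) n (n + 1) (τ'.nat 7) (τ'.nat 8) (τ'.nat 5 1))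
    (hpot : potential (n + 2) m (τ.nat 10) (τ.nat 11) (n + 1) (τ.nat 7) (τ.nat 8) (τ.nat 5 1) <
      potential (n + 2) m (τ.nat 10) (τ.nat 11) (n + 1) (τ'.nat 7) (τ'.nat 8) (τ'.nat 5 1)) :
    FlowInvariant n m τ' ∧ flowVariant n m τ' < flowVariant n m τ := by
  refine ⟨⟨by rwa [h₁₀, h₁₁], by omega, by rw [hi']; simp⟩, ?_⟩
  rw [flowVariant, flowVariant, h₁₀, h₁₁, hi']
  have h₁ := hτ'.potential_le
  have h₂ := hτ.le
  generalize potential (n + 2) m (τ.nat 10) (τ.nat 11) (n + 1) (τ.nat 7) (τ.nat 8)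
    (τ.nat 5 1) = p at *
  generalize potential (n + 2) m (τ.nat 10) (τ.nat 11) (n + 1) (τ'.nat 7) (τ'.nat 8)
    (τ'.nat 5 1) = p' at *
  push_cast at h₁
  -- Nonnegativity, from the bound on the potential, ensures that `toNat` does not hide the
  -- decrease.
  have h₃ : (0 : ℤ) ≤ 2 * ((n + 2) * (n + 2)) + (n + 3) * m - p' := by linarith
  have h₄ : ((m : ℤ) + 1) * (2 * ((n + 2) * (n + 2)) + (n + 3) * m - p') + (m + 1) ≤
      (m + 1) * (2 * ((n + 2) * (n + 2)) + (n + 3) * m - p) := by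
    have : (0 : ℤ) ≤ m + 1 := by positivity
    nlinarith
  have h₅ : (0 : ℤ) ≤ (m + 1) * (2 * ((n + 2) * (n + 2)) + (n + 3) * m - p') := by positivity
  push_cast
  omega

theorem flowBody_step (hn : τ.nat 0 0 = n) (hm : τ.nat 0 1 = m)
    (htl : ∀ e < m, τ.nat 10 e < n + 2) (hhd : ∀ e < m, τ.nat 11 e < n + 2)
    (hτ : FlowInvariant n m τ) (hb : τ.nat 8 (τ.nat 5 1) < n + 2) :
    FlowInvariant n m (flowBody.exec τ) ∧
      flowVariant n m (flowBody.exec τ) < flowVariant n m τ := by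
  have hpre := hτ.preflow
  by_cases h₁ : τ.nat 5 1 = n + 1
  · rw [flowBody, Program.exec_branch_of_holds
      (by rw [Test.holds_natEq]; simpa [reg, param, NExpr.eval, hn] using h₁)]
    rw [h₁] at hpre
    refine flowVariant_lt ?_ ?_ hτ ?_ ?_ ?_ <;>
      simp [Program.exec, setReg, param, NExpr.eval, State.nat_setNat_self,
        State.nat_setNat_of_ne, hn]
    · exact hpre.restart (by omega)
    · rw [h₁]
      exact hpre.potential_restart (by omega)
  rw [flowBody, Program.exec_branch_of_not_holds
      (by rw [Test.holds_natEq]; simpa [reg, param, NExpr.eval, hn] using h₁)]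
  by_cases h₂ : m ≤ τ.nat 5 0
  · rw [Program.exec_branch_of_holds
      (by simpa [Test.Holds, reg, param, NExpr.eval, hm] using h₂)]
    refine flowVariant_lt ?_ ?_ hτ ?_ ?_ ?_ <;>
      simp [Program.exec, setReg, reg, NExpr.eval, State.nat_setNat_self,
        State.nat_setNat_of_ne]
    -- The scan has passed all `m` edges, so the invariant excludes every admissible edge.
    · exact hpre.relabel h₁ hb fun e he => hτ.not_admissible e (he.trans_le h₂)
    · exact hpre.potential_relabel
  rw [Program.exec_branch_of_not_holds
      (by simpa [Test.Holds, reg, param, NExpr.eval, hm] using h₂)]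
  rw [not_le] at h₂
  by_cases h₃ : τ.nat 7 (τ.nat 5 0) = 0 ∧ τ.nat 10 (τ.nat 5 0) = τ.nat 5 1 ∧
      τ.nat 8 (τ.nat 11 (τ.nat 5 0)) < τ.nat 8 (τ.nat 5 1)
  · rw [Program.exec_branch_of_holds
      (by simpa [Test.Holds, Test.holds_natEq, Test.holds_natLt, reg, NExpr.eval] using h₃)]
    obtain ⟨h₄, h₅⟩ := hpre.pushForward h₂ h₃.1 h₃.2.1 h₃.2.2 (hhd _ h₂)
    refine flowVariant_lt ?_ ?_ hτ ?_ ?_ ?_ <;>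
      simp [pushForward, Program.exec, setReg, reg, NExpr.eval, State.nat_setNat_self,
        State.nat_setNat_of_ne]
    · exact h₄
    · exact h₅
  rw [Program.exec_branch_of_not_holds
      (by simpa [Test.Holds, Test.holds_natEq, Test.holds_natLt, reg, NExpr.eval] using h₃)]
  by_cases h₄ : τ.nat 7 (τ.nat 5 0) = 1 ∧ τ.nat 11 (τ.nat 5 0) = τ.nat 5 1 ∧
      τ.nat 8 (τ.nat 10 (τ.nat 5 0)) < τ.nat 8 (τ.nat 5 1)
  · rw [Program.exec_branch_of_holds
      (by simpa [Test.Holds, Test.holds_natEq, Test.holds_natLt, reg, NExpr.eval] using h₄)]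
    obtain ⟨h₄, h₅⟩ := hpre.pushBackward h₂ h₄.1 h₄.2.1 h₄.2.2 (htl _ h₂)
    refine flowVariant_lt ?_ ?_ hτ ?_ ?_ ?_ <;>
      simp [pushBackward, Program.exec, setReg, reg, NExpr.eval, State.nat_setNat_self,
        State.nat_setNat_of_ne]
    · exact h₄
    · exact h₅
  rw [Program.exec_branch_of_not_holds
      (by simpa [Test.Holds, Test.holds_natEq, Test.holds_natLt, reg, NExpr.eval] using h₄)]
  have hexec : (incReg 0).exec τ = τ.setNat 5 0 (τ.nat 5 0 + 1) := rfl
  rw [hexec]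
  constructor
  · refine ⟨?_, ?_, ?_⟩ <;> simp [State.nat_setNat_self, State.nat_setNat_of_ne]
    · exact hpre
    · exact h₂
    · intro e he
      rcases lt_or_eq_of_le he with he | rfl
      · exact hτ.not_admissible e he
      · exact not_or.2 ⟨h₃, h₄⟩
  · have h₆ := hpre.potential_le
    simp only [flowVariant, State.nat_setNat_self, State.nat_setNat_of_ne, ne_eq,
      Nat.reduceEqDiff, not_false_eq_true, Function.update_self, one_ne_zero,
      Function.update_of_ne]
    generalize potential (n + 2) m (τ.nat 10) (τ.nat 11) (n + 1) (τ.nat 7) (τ.nat 8)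
      (τ.nat 5 1) = p at *
    push_cast at h₆ ⊢
    have h₇ : (0 : ℤ) ≤ 2 * ((n + 2) * (n + 2)) + (n + 3) * m - p := by linarith
    have h₈ : (0 : ℤ) ≤ (m + 1) * (2 * ((n + 2) * (n + 2)) + (n + 3) * m - p) := by positivity
    omega

theorem halts_flow (H : Loaded G s t P σ) (h₇ : σ.nat 7 = 0) (h₈ : σ.nat 8 = 0)
    (htl : ∀ e < m, σ.nat 10 e < n + 2) (hhd : ∀ e < m, σ.nat 11 e < n + 2) :
    Halts flow σ (200 * (n + m + 3) ^ 4) (fun τ => ∃ f cur,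
      IsPreflow (n + 2) m (σ.nat 10) (σ.nat 11) n (n + 1) f (τ.nat 8) cur ∧
      n + 2 ≤ τ.nat 8 cur) := by
  have H₁ := (H.setNat (a := 5) (by norm_num) 1 n).setNat (a := 5) (by norm_num) 0 0
  have hY := le_pow_four (show n + 3 ≤ n + m + 3 by omega)
  refine Halts.setReg_seq (U := 198 * (n + m + 3) ^ 4)
    (by simp only [NExpr.cost, param]; omega) ?_
  refine Halts.setReg_seq (U := 197 * (n + m + 3) ^ 4) (by simp only [NExpr.cost]; omega) ?_
  have hparam : (param 0).eval σ = n := H.vertices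
  simp only [hparam, NExpr.eval]
  refine halts_loop
    (by simp [flowBody, pushForward, pushBackward, incReg, setReg, Program.LoopFree])
    (FlowInvariant n m) (flowVariant n m) ?_ ?_ ?_ ?_
  · refine ⟨?_, ?_, ?_⟩ <;>
      simp [State.nat_setNat_self, State.nat_setNat_of_ne, h₇, h₈]
    exact isPreflow_zero (by omega)
  -- The potential starts at zero and the scan at edge `0`; the extra turn completes the leftover
  -- `m` to another factor `m + 1`.
  · have h₁ : flowVariant n m ((σ.setNat 5 1 n).setNat 5 0 0) + 1 =
        (m + 1) * (2 * ((n + 2) * (n + 2)) + (n + 3) * m + 1) := by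
      simp only [flowVariant, State.nat_setNat_self, State.nat_setNat_of_ne, ne_eq,
        Nat.reduceEqDiff, not_false_eq_true, Function.update_self, one_ne_zero,
        Function.update_of_ne, h₇, h₈]
      have := potential_zero (N := n + 2) (m := m) (tl := σ.nat 10) (hd := σ.nat 11)
        (show n ≠ n + 1 by omega)
      rw [show (0 : ℕ → ℕ) = fun _ => 0 from rfl, this, Nat.cast_zero, sub_zero, sub_zero]
      zify
      rw [Int.toNat_of_nonneg (by positivity)]
      ring
    rw [h₁]
    refine (Nat.mul_le_mul_right _ (flow_bound n m)).trans ?_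
    rw [mul_comm]
    refine Nat.mul_le_mul_right _ ?_
    decide
  · rintro τ hF hτ hb
    have Hτ : Loaded G s t P τ := H₁.frame hF (by decide) (by decide)
    rw [Test.holds_natLt] at hb
    simp only [cutVertices, reg, param, NExpr.eval, Hτ.vertices, not_lt] at hb
    refine ⟨τ.nat 7, _, ?_, hb⟩
    have := hτ.preflow
    rwa [hF.nat 10 (by decide), hF.nat 11 (by decide)] at this
  · rintro τ hF hτ hb
    have Hτ : Loaded G s t P τ := H₁.frame hF (by decide) (by decide)
    rw [Test.holds_natLt] at hb
    simp only [cutVertices, reg, param, NExpr.eval, Hτ.vertices] at hb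
    exact flowBody_step Hτ.vertices Hτ.edges
      (by rw [hF.nat 10 (by decide)]; exact htl) (by rw [hF.nat 11 (by decide)]; exact hhd) hτ hb

/-- The label `0` of the sink starts a growing initial segment of labels in use. The segment cannot
have more than `n + 2` elements, which bounds both the search and the gap found. -/
theorem halts_gap (H : Loaded G s t P σ) (h₀ : σ.nat 8 (n + 1) = 0) :
    Halts gap σ (100 * (n + m + 3) ^ 4) (fun τ =>
      0 < τ.nat 5 1 ∧ τ.nat 5 1 ≤ n + 2 ∧ ∀ v < n + 2, σ.nat 8 v ≠ τ.nat 5 1) := by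
  have H₁ := (H.setNat (a := 5) (by norm_num) 1 1).setNat (a := 5) (by norm_num) 0 0
  have hY := le_pow_four (show n + 3 ≤ n + m + 3 by omega)
  refine Halts.setReg_seq (U := 99 * (n + m + 3) ^ 4) (by simp only [NExpr.cost]; omega) ?_
  refine Halts.setReg_seq (U := 98 * (n + m + 3) ^ 4) (by simp only [NExpr.cost]; omega) ?_
  refine halts_loop (by simp [gapBody, incReg, setReg, Program.LoopFree])
    (fun τ => 0 < τ.nat 5 1 ∧ (∀ j < τ.nat 5 1, ∃ v < n + 2, σ.nat 8 v = j) ∧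
      τ.nat 5 0 ≤ n + 2 ∧ ∀ v < τ.nat 5 0, σ.nat 8 v ≠ τ.nat 5 1)
    (fun τ => (n + 2 - τ.nat 5 1) * (n + 3) + (n + 2 - τ.nat 5 0)) ?_ ?_ ?_ ?_
  · simp only [State.nat_setNat_self, NExpr.eval, Function.update_self, ne_eq, one_ne_zero,
      not_false_eq_true, Function.update_of_ne]
    exact ⟨by omega, fun j hj => ⟨n + 1, by omega, by omega⟩, by omega, by simp⟩
  · have h₁ : (n + 1) * (n + 3) + (n + 2) + 1 ≤ (n + m + 3) ^ 4 := by
      calc (n + 1) * (n + 3) + (n + 2) + 1 = (n + 2) * (n + 3) := by ring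
        _ ≤ (n + m + 3) * (n + m + 3) := Nat.mul_le_mul (by omega) (by omega)
        _ = (n + m + 3) ^ 2 := by ring
        _ ≤ (n + m + 3) ^ 4 := Nat.pow_le_pow_right (by omega) (by norm_num)
    simp only [State.nat_setNat_self, NExpr.eval, Function.update_self, ne_eq, one_ne_zero,
      not_false_eq_true, Function.update_of_ne]
    refine (Nat.mul_le_mul_right _ (show _ ≤ _ from h₁)).trans ?_
    rw [mul_comm]
    refine Nat.mul_le_mul_right _ ?_
    decide
  · rintro τ hF ⟨h₁, h₂, h₃, h₄⟩ hb
    have Hτ : Loaded G s t P τ := H₁.frame hF (by decide) (by decide)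
    rw [Test.holds_natLt] at hb
    simp only [cutVertices, reg, param, NExpr.eval, Hτ.vertices] at hb
    exact ⟨h₁, le_of_forall_exists_label h₂, fun v hv => h₄ v (by omega)⟩
  · rintro τ hF ⟨h₁, h₂, h₃, h₄⟩ hb
    have Hτ : Loaded G s t P τ := H₁.frame hF (by decide) (by decide)
    have h₈ : τ.nat 8 = σ.nat 8 := hF.nat 8 (by decide)
    rw [Test.holds_natLt] at hb
    simp only [cutVertices, reg, param, NExpr.eval, Hτ.vertices] at hb
    by_cases h₅ : σ.nat 8 (τ.nat 5 0) = τ.nat 5 1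
    · rw [gapBody, Program.exec_branch_of_holds
        (by rw [Test.holds_natEq]; simpa [reg, NExpr.eval, h₈] using h₅)]
      simp only [Program.exec, incReg, setReg, reg, NExpr.eval, State.nat_setNat_self,
          Function.update_self, ne_eq, one_ne_zero, not_false_eq_true, Function.update_of_ne]
      have h₆ : ∀ j < τ.nat 5 1 + 1, ∃ v < n + 2, σ.nat 8 v = j := by
        intro j hj
        rcases Nat.lt_succ_iff_lt_or_eq.1 hj with hj | rfl
        · exact h₂ j hj
        · exact ⟨_, hb, h₅⟩
      -- Guarantees that the truncated difference in the variant really decreases.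
      have h₇ := le_of_forall_exists_label h₆
      refine ⟨⟨by omega, h₆, by omega, by simp⟩, ?_⟩
      have : n + 2 - τ.nat 5 1 = n + 2 - (τ.nat 5 1 + 1) + 1 := by omega
      rw [this, add_mul]
      omega
    · rw [gapBody, Program.exec_branch_of_not_holds
        (by rw [Test.holds_natEq]; simpa [reg, NExpr.eval, h₈] using h₅)]
      simp only [Program.exec, incReg, setReg, reg, NExpr.eval, State.nat_setNat_self,
          Function.update_self, ne_eq, one_ne_zero, not_false_eq_true, Function.update_of_ne]
      refine ⟨⟨h₁, h₂, hb, fun v hv => ?_⟩, by omega⟩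
      rcases Nat.lt_succ_iff_lt_or_eq.1 hv with hv | rfl
      · exact h₄ v hv
      · exact h₅

theorem halts_outputCut (H : Loaded G s t P σ) :
    Halts outputCut σ (100 * (n + m + 3) ^ 4) (fun τ => ∀ e < m,
      τ.nat 4 e = if σ.nat 5 1 ≤ σ.nat 8 (σ.nat 10 e) ∧ σ.nat 8 (σ.nat 11 e) < σ.nat 5 1
        then 1 else 0) := by
  have H₁ := H.setNat (a := 5) (by norm_num) 0 0
  have hY := le_pow_four (show m + 3 ≤ n + m + 3 by omega)
  refine Halts.setReg_seq (U := 99 * (n + m + 3) ^ 4) (by simp only [NExpr.cost]; omega) ?_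
  refine halts_loop (by simp [outputCutBody, incReg, setReg, Program.LoopFree])
    (fun τ => τ.nat 5 0 ≤ m ∧ τ.nat 5 1 = σ.nat 5 1 ∧ ∀ e < τ.nat 5 0,
      τ.nat 4 e = if σ.nat 5 1 ≤ σ.nat 8 (σ.nat 10 e) ∧ σ.nat 8 (σ.nat 11 e) < σ.nat 5 1
        then 1 else 0)
    (fun τ => m - τ.nat 5 0) (by simp [State.nat_setNat_self, NExpr.eval]) ?_ ?_ ?_
  · simp only [State.nat_setNat_self, NExpr.eval, Function.update_self, Program.cost, Test.cost,
      NExpr.cost, outputCutBody, incReg, setReg, reg, param, Test.natLt]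
    omega
  · rintro τ hF ⟨hi, -, hl⟩ hb e he
    have Hτ : Loaded G s t P τ := H₁.frame hF (by decide) (by decide)
    rw [Test.holds_natLt] at hb
    simp only [reg, param, NExpr.eval, Hτ.edges] at hb
    exact hl e (by omega)
  · rintro τ hF ⟨hi, hk, hl⟩ hb
    have Hτ : Loaded G s t P τ := H₁.frame hF (by decide) (by decide)
    have h₈ : τ.nat 8 = σ.nat 8 := hF.nat 8 (by decide)
    have h₁₀ : τ.nat 10 = σ.nat 10 := hF.nat 10 (by decide)
    have h₁₁ : τ.nat 11 = σ.nat 11 := hF.nat 11 (by decide)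
    rw [Test.holds_natLt] at hb
    simp only [reg, param, NExpr.eval, Hτ.edges] at hb
    have hbranch : (Test.conj (.natLe (reg 1) (.get 8 (.get 10 (reg 0))))
        (.natLt (.get 8 (.get 11 (reg 0))) (reg 1))).Holds τ ↔
        σ.nat 5 1 ≤ σ.nat 8 (σ.nat 10 (τ.nat 5 0)) ∧
          σ.nat 8 (σ.nat 11 (τ.nat 5 0)) < σ.nat 5 1 := by
      simp only [Test.Holds, Test.holds_natLt, reg, NExpr.eval, h₈, h₁₀, h₁₁, hk]
    have hexec : outputCutBody.exec τ = (τ.setNat 4 (τ.nat 5 0)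
        (if σ.nat 5 1 ≤ σ.nat 8 (σ.nat 10 (τ.nat 5 0)) ∧
          σ.nat 8 (σ.nat 11 (τ.nat 5 0)) < σ.nat 5 1 then 1 else 0)).setNat 5 0
          (τ.nat 5 0 + 1) := by
      rw [outputCutBody, Program.exec]
      split_ifs with h
      · rw [Program.exec_branch_of_holds (hbranch.2 h)]
        simp [Program.exec, incReg, setReg, reg, NExpr.eval, State.nat_setNat_of_ne]
      · rw [Program.exec_branch_of_not_holds (hbranch.not.2 h)]
        simp [Program.exec, incReg, setReg, reg, NExpr.eval, State.nat_setNat_of_ne]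
    rw [hexec]
    simp only [State.nat_setNat_self, State.nat_setNat_of_ne, ne_eq, Nat.reduceEqDiff,
      not_false_eq_true, Function.update_self, one_ne_zero, Function.update_of_ne]
    refine ⟨⟨hb, hk, fun e he => ?_⟩, by omega⟩
    rw [Function.update_apply]
    by_cases h : e = τ.nat 5 0
    · rw [if_pos h, h]
    · rw [if_neg h]
      exact hl e (by omega)

end RAM

/-! ### The contracted digraph as input of the cut computation -/

namespace WeightedDigraph

variable {n m : ℕ} {G : WeightedDigraph n m} {d : Fin n → ℝ} {V : List (Fin n)}
  {P : List (Fin m)}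

theorem cutTail_lt (e : Fin m) : G.cutTail d V P e < n + 2 := by
  have := (G.tail e).2
  rw [cutTail]
  split_ifs <;> omega

theorem cutHead_lt (e : Fin m) : G.cutHead d V P e < n + 2 := by
  have := (G.head e).2
  rw [cutHead]
  split_ifs <;> omega

/-- Identifies edges in `Fin m` with array indices; the cells beyond `m` play no role. -/
theorem card_cutEdges {tl hd : ℕ → ℕ}
    (h : ∀ e : Fin m, tl e = G.cutTail d V P e ∧ hd e = G.cutHead d V P e) (A : Finset ℕ) :
    (G.cutEdges d V P A).card = UnitFlow.cutCard m tl hd A := by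
  rw [UnitFlow.cutCard, ← Finset.card_map Fin.valEmbedding]
  congr 1
  ext e
  simp only [Finset.mem_map, mem_cutEdges, Fin.valEmbedding_apply, Finset.mem_filter,
    Finset.mem_range]
  constructor
  · rintro ⟨f, hf, rfl⟩
    rw [(h f).1, (h f).2]
    exact ⟨f.2, hf⟩
  · rintro ⟨he, hA⟩
    refine ⟨⟨e, he⟩, ?_, rfl⟩
    rwa [← (h ⟨e, he⟩).1, ← (h ⟨e, he⟩).2]

end WeightedDigraph

/-! ### Assembly of the phases -/

namespace RAM

variable {n m : ℕ} {G : WeightedDigraph n m} {s t : Fin n} {P : List (Fin m)} {σ : State}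

theorem loaded_inputState : Loaded G s t P (inputState G s t P) :=
  ⟨fun _ _ => rfl, rfl⟩

open UnitFlow in
/-- The phases of the program that compute a minimum cut. -/
theorem halts_minimumCut {d : Fin n → ℝ} (H : Loaded G s t P σ) (hd : G.IsPotential d)
    (hP : G.IsShortestPath s t P) (hst : d s + G.length P = d t) (h₇ : σ.nat 7 = 0)
    (h₈ : σ.nat 8 = 0)
    (hcut : ∀ e : Fin m, σ.nat 10 e = G.cutTail d (s :: P.map G.head) P e ∧
      σ.nat 11 e = G.cutHead d (s :: P.map G.head) P e) :
    Halts (.seq flow (.seq gap outputCut)) σ (400 * (n + m + 3) ^ 4) (fun τ =>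
      ∃ S : Finset (Fin m), IsMinimumAntiForcingSet (G.shortestPaths s t) P.toFinset S ∧
        Outputs τ S) := by
  have htl : ∀ e < m, σ.nat 10 e < n + 2 := fun e he => by
    rw [(hcut ⟨e, he⟩).1]; exact WeightedDigraph.cutTail_lt _
  have hhd : ∀ e < m, σ.nat 11 e < n + 2 := fun e he => by
    rw [(hcut ⟨e, he⟩).2]; exact WeightedDigraph.cutHead_lt _
  refine (halts_flow H h₇ h₈ htl hhd).seq (U := 200 * (n + m + 3) ^ 4) (by omega) ?_
  rintro τ₁ hF₁ ⟨f, cur, hf, hcur⟩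
  have H₁ : Loaded G s t P τ₁ := H.frame hF₁ (by decide) (by decide)
  refine (halts_gap H₁ hf.label_sink).seq (U := 100 * (n + m + 3) ^ 4) (by omega) ?_
  rintro τ₂ hF₂ ⟨hk₀, hk, hgap⟩
  have H₂ : Loaded G s t P τ₂ := H₁.frame hF₂ (by decide) (by decide)
  have h₈' : τ₂.nat 8 = τ₁.nat 8 := hF₂.nat 8 (by decide)
  have h₁₀ : τ₂.nat 10 = σ.nat 10 := (hF₂.nat 10 (by decide)).trans (hF₁.nat 10 (by decide))
  have h₁₁ : τ₂.nat 11 = σ.nat 11 := (hF₂.nat 11 (by decide)).trans (hF₁.nat 11 (by decide))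
  refine (halts_outputCut H₂).mono le_rfl fun τ _ hτ => ?_
  -- The exit conditions of the two loops meet: the gap is at most `n + 2`, and the label at `cur`
  -- is at least `n + 2`.
  obtain ⟨ha, hb, hA⟩ := hf.cutCard_le htl hhd hk₀ (hk.trans hcur) hgap
  refine ⟨_, WeightedDigraph.isMinimumAntiForcingSet_cutEdges hd hP hst ha hb fun B haB hbB => ?_,
    fun e => ?_⟩
  · rw [WeightedDigraph.card_cutEdges hcut, WeightedDigraph.card_cutEdges hcut]
    exact hA B haB hbB
  · rw [hτ e e.2, h₈', h₁₀, h₁₁]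
    refine if_congr ?_ rfl rfl
    rw [WeightedDigraph.mem_cutEdges, ← (hcut e).1, ← (hcut e).2]
    simp only [Finset.mem_filter, Finset.mem_range, htl e e.2, hhd e e.2, true_and, not_le]

theorem halts_antiForcing (hP : G.IsShortestPath s t P) :
    Halts antiForcing (inputState G s t P) (700 * (n + m + 3) ^ 4) (fun τ =>
      ∃ S : Finset (Fin m), IsMinimumAntiForcingSet (G.shortestPaths s t) P.toFinset S ∧
        Outputs τ S) := by
  refine (halts_markPath loaded_inputState hP.1 rfl rfl rfl).seq
    (U := 650 * (n + m + 3) ^ 4) (by omega) ?_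
  rintro τ₁ hF₁ ⟨H₁, hl, he, hv⟩
  refine (halts_initLabels H₁ hl).seq (U := 600 * (n + m + 3) ^ 4) (by omega) ?_
  intro τ₂ hF₂ hlab
  have H₂ : Loaded G s t P τ₂ := H₁.frame hF₂ (by decide) (by decide)
  refine (halts_relax H₂ hlab).seq (U := 500 * (n + m + 3) ^ 4) (by omega) ?_
  intro τ₃ hF₃ hR
  have H₃ : Loaded G s t P τ₃ := H₂.frame hF₃ (by decide) (by decide)
  refine (halts_contract H₃ (fun _ => rfl) ?_ ?_).seq (U := 400 * (n + m + 3) ^ 4) (by omega) ?_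
  · rw [hF₃.nat 9 (by decide), hF₂.nat 9 (by decide)]; exact he
  · rw [hF₃.nat 6 (by decide), hF₂.nat 6 (by decide)]; exact hv
  intro τ₄ hF₄ hcut
  have H₄ : Loaded G s t P τ₄ := H₃.frame hF₄ (by decide) (by decide)
  refine halts_minimumCut H₄ hR.isPotential hP ?_ ?_ ?_ hcut
  · rw [hR.apply_source, hR.apply_sink hP, zero_add]
  -- The flow and label arrays are untouched since the input and hence still zero.
  all_goals
    rw [hF₄.nat _ (by decide), hF₃.nat _ (by decide), hF₂.nat _ (by decide),
      hF₁.nat _ (by decide)]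
    rfl

end RAM

theorem mainTheorem5 :
    ∃ (prog : RAM.Program) (p : Polynomial ℕ),
      ∀ (n m : ℕ) (G : WeightedDigraph n m) (s t : Fin n) (P : List (Fin m)),
        G.IsShortestPath s t P →
        ∃ (S : Finset (Fin m)) (T : ℕ) (τ : RAM.State),
          IsMinimumAntiForcingSet (G.shortestPaths s t) P.toFinset S ∧
          RAM.Run prog (inputState G s t P) T τ ∧
          T ≤ p.eval (n + m) ∧
          Outputs τ S := by
  -- The coefficient `700` is the sum of the budgets of the seven phases.
  refine ⟨RAM.antiForcing, Polynomial.C 700 * (Polynomial.X + 3) ^ 4, fun n m G s t P hP => ?_⟩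
  obtain ⟨T, τ, hr, hT, S, hS, hτ⟩ := RAM.halts_antiForcing hP
  exact ⟨S, T, τ, hS, hr, by simpa using hT, hτ⟩
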